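/- Let $K$ be a field, $d\ge 1$ an integer and $S=K[t_0,\dots,t_d]$. Let $P\subset S$ be the ideal of the rational normal curve, i.e. the kernel of the $K$-algebra map $S\to K[x,y]$, $t_i\mapsto x^{d-i}y^i$, and let $$T_d=\begin{pmatrix} t_0&t_1&\cdots&t_{d-1}\\ t_1&t_2&\cdots&t_d\end{pmatrix}.$$ Let $G$ be a graph with vertex set $V\subseteq\{t_0,\dots,t_d\}$ and edge set $E$, let $Q=\{t_0,\dots,t_d\}\setminus V$ and let $\phi:Q\to E$ be a map. Put $I(G,\phi)=J+H$, where $J$ is generated by the products $xy$ of two distinct non-adjacent vertices $x,y\in V$ and by the products of three distinct vertices, and $H=(Q)^2+(qv : q\in Q,\ v\in V,\ v\notin\phi(q))$. For a term order $\tau$, $\operatorname{in}_\tau(P)$ is the ideal generated by the initial monomials of the non-zero elements of $P$. For a vector $a\in\mathbf{Q}_{\ge0}^{d+1}$, $\operatorname{in}_a(P)$ is the ideal generated by the initial forms $\operatorname{in}_a(f)$ of the non-zero $f\in P$, where $\operatorname{in}_a(f)$ is the sum of those terms $\lambda t^\alpha$ of $f$ for which $\sum_i a_i\alpha_i$ is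 maximal. An ideal $I$ is called Cohen-Macaulay if $S/I$ is a Cohen-Macaulay ring. **Theorem.** Let $I$ be a monomial ideal of $S$. The following conditions are equivalent: 1. There exists a sequence $0=i_0<i_1<\dots<i_k=d$ such that $I=I(G,\phi)$, where $V=\{t_{i_0},\dots,t_{i_k}\}$, $G$ is the line with vertex set $V$ and edge set $E=\{\{t_{i_j},t_{i_{j+1}}\} : 0\le j\le k-1\}$, and $\phi:Q\to E$ sends $t_s$ to $\{t_{i_j},t_{i_{j+1}}\}$ where $i_j<s<i_{j+1}$. 2. There exists a sequence $0=i_0<i_1<\dots<i_k=d$ such that $I$ is generated by (i) the main diagonals $t_{v-1}t_r$ of the $2$-minors of $T_d$ with column indices $v,r\in\{1,\dots,d\}$ such that $v\le i_j<r$ for some $j$, and (ii) the anti-diagonals $t_vt_{r-1}$ of the $2$-minors of $T_d$ with column indices $v,r\in\{1,\dots,d\}$ such that $i_j<v<r\le i_{j+1}$ for some $j$. 3. $I$ is Cohen-Macaulay and is an initial ideal of $P$ with respect to a term order: $I=\operatorname{in}_\tau(P)$ for some term order $\tau$. 4. $I$ is Cohen-Macaulay and is an initial ideal of $P$ with respect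 to a vector: $I=\operatorname{in}_a(P)$ for some $a\in\mathbf{Q}_{\ge0}^{d+1}$. -/

import Mathlib

noncomputable section

namespace RNC

/-! ### Cohen-Macaulay rings -/

/-- A local ring is Cohen-Macaulay if its maximal ideal contains a regular sequence whose length
is the Krull dimension (depth equals dimension). To be used for Noetherian rings. -/
def IsLocalCohenMacaulay (R : Type*) [CommRing R] [IsLocalRing R] : Prop :=
  ∃ rs : List R, (∀ r ∈ rs, r ∈ IsLocalRing.maximalIdeal R) ∧
    RingTheory.Sequence.IsRegular R rs ∧ ((rs.length : ℕ∞) : WithBot ℕ∞) = ringKrullDim R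

/-- A ring is Cohen-Macaulay if it is Noetherian and all its localizations at maximal ideals are
Cohen-Macaulay local rings. -/
def IsCohenMacaulay (R : Type*) [CommRing R] : Prop :=
  IsNoetherianRing R ∧
    ∀ (M : Ideal R) [M.IsMaximal], IsLocalCohenMacaulay (Localization.AtPrime M)

/-! ### Monomial ideals and initial ideals -/

/-- An ideal of a polynomial ring is monomial if it is generated by monomials. -/
def IsMonomialIdeal {σ K : Type*} [Field K] (I : Ideal (MvPolynomial σ K)) : Prop :=
  ∃ A : Set (σ →₀ ℕ), I = Ideal.span ((fun α => MvPolynomial.monomial α (1 : K)) '' A)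

/-- The initial ideal of `I` with respect to a term order `τ`: the ideal generated by the initial
monomials of the non-zero elements of `I`. -/
def termInitialIdeal {σ K : Type*} [Field K] (τ : MonomialOrder σ)
    (I : Ideal (MvPolynomial σ K)) : Ideal (MvPolynomial σ K) :=
  Ideal.span {g | ∃ f ∈ I, f ≠ 0 ∧ g = MvPolynomial.monomial (τ.degree f) (1 : K)}

open Classical in
/-- The initial form of `f` with respect to a weight vector `a`: the sum of the terms of `f`
whose weight `∑ i, a i * α i` is maximal among the terms of `f`. -/
def initialForm {σ K : Type*} [Field K] (a : σ → ℚ) (f : MvPolynomial σ K) : MvPolynomial σ K :=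
  ∑ α ∈ f.support with ∀ β ∈ f.support, Finsupp.weight a β ≤ Finsupp.weight a α,
    MvPolynomial.monomial α (f.coeff α)

/-- The initial ideal of `I` with respect to a weight vector `a`: the ideal generated by the
initial forms of the non-zero elements of `I`. -/
def weightInitialIdeal {σ K : Type*} [Field K] (a : σ → ℚ)
    (I : Ideal (MvPolynomial σ K)) : Ideal (MvPolynomial σ K) :=
  Ideal.span {g | ∃ f ∈ I, f ≠ 0 ∧ g = initialForm a f}

/-! ### The rational normal curve -/

/-- The ideal of the rational normal curve of degree `d`: the kernel of the `K`-algebra map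
`K[t_0, …, t_d] → K[x, y]` sending `t_i` to `x ^ (d - i) * y ^ i`. -/
def curveIdeal (K : Type*) [Field K] (d : ℕ) : Ideal (MvPolynomial (Fin (d + 1)) K) :=
  RingHom.ker (MvPolynomial.aeval (R := K) fun i : Fin (d + 1) =>
    (MvPolynomial.X 0 ^ (d - (i : ℕ)) * MvPolynomial.X 1 ^ (i : ℕ) : MvPolynomial (Fin 2) K))

/-- The `2 × d` matrix with rows `t_0, …, t_{d-1}` and `t_1, …, t_d`. The column with (one-based)
index `v` is the column `v - 1 : Fin d`. -/
def hankel (K : Type*) [Field K] (d : ℕ) :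
    Matrix (Fin 2) (Fin d) (MvPolynomial (Fin (d + 1)) K) :=
  Matrix.of ![fun c => MvPolynomial.X c.castSucc, fun c => MvPolynomial.X c.succ]

/-! ### The ideals attached to graphs -/

/-- The square-free monomial ideal associated with a graph `G` on a set `V` of variables (extended
to the polynomial ring in all variables): it is generated by the products of two distinct
non-adjacent vertices and by the products of three distinct vertices. -/
def graphIdeal (K : Type*) [Field K] {σ : Type*} {V : Set σ} (G : SimpleGraph V) :
    Ideal (MvPolynomial σ K) :=
  Ideal.span
    ({g | ∃ x y : V, x ≠ y ∧ ¬ G.Adj x y ∧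
        g = MvPolynomial.X (x : σ) * MvPolynomial.X (y : σ)} ∪
     {g | ∃ x y z : V, x ≠ y ∧ x ≠ z ∧ y ≠ z ∧
        g = MvPolynomial.X (x : σ) * MvPolynomial.X (y : σ) * MvPolynomial.X (z : σ)})

/-- The ideal `I(G, φ) = J + H`, where `Q` is the complement of `V`, `φ : Q → E(G)`, `J` is the
ideal of `G` and `H = (Q)^2 + (q v : q ∈ Q, v ∈ V, v ∉ φ q)`. -/
def treeIdeal (K : Type*) [Field K] {σ : Type*} {V : Set σ} (G : SimpleGraph V)
    (φ : (Vᶜ : Set σ) → G.edgeSet) : Ideal (MvPolynomial σ K) :=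
  graphIdeal K G ⊔
    (Ideal.span (MvPolynomial.X '' Vᶜ) ^ 2 ⊔
      Ideal.span {g | ∃ (q : (Vᶜ : Set σ)) (v : V), v ∉ (φ q : Sym2 V) ∧
        g = MvPolynomial.X (q : σ) * MvPolynomial.X (v : σ)})

/-- A sequence `0 = i_0 < i_1 < ⋯ < i_k = d`. -/
def IsSubdivision (d k : ℕ) (i : Fin (k + 1) → Fin (d + 1)) : Prop :=
  StrictMono i ∧ i 0 = 0 ∧ i (Fin.last k) = Fin.last d

/-- The edge `{t_{i_j}, t_{i_{j+1}}}` on the vertex set `{t_{i_0}, …, t_{i_k}}`. -/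
def lineEdge {d k : ℕ} (i : Fin (k + 1) → Fin (d + 1)) (j : Fin k) : Sym2 (Set.range i) :=
  s(⟨i j.castSucc, Set.mem_range_self _⟩, ⟨i j.succ, Set.mem_range_self _⟩)

/-- The line with vertex set `{t_{i_0}, …, t_{i_k}}` and edges `{t_{i_j}, t_{i_{j+1}}}`. -/
def lineGraph {d k : ℕ} (i : Fin (k + 1) → Fin (d + 1)) : SimpleGraph (Set.range i) :=
  SimpleGraph.fromEdgeSet (Set.range (lineEdge i))

/-- The map `φ` from the remaining variables to the edges of the line sends `t_s` to the edge
`{t_{i_j}, t_{i_{j+1}}}` with `i_j < s < i_{j+1}`. -/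
def IsLineMap {d k : ℕ} (i : Fin (k + 1) → Fin (d + 1))
    (φ : ((Set.range i)ᶜ : Set (Fin (d + 1))) → (lineGraph i).edgeSet) : Prop :=
  ∀ (s : ((Set.range i)ᶜ : Set (Fin (d + 1)))) (j : Fin k),
    i j.castSucc < (s : Fin (d + 1)) → (s : Fin (d + 1)) < i j.succ →
      (φ s : Sym2 (Set.range i)) = lineEdge i j

/-- The ideal generated by the main diagonals of the minors with (one-based) column indices `v, r`
such that `v ≤ i_j < r` for some `j`, and the anti-diagonals of the minors with column indices
`v, r` such that `i_j < v < r ≤ i_{j+1}` for some `j`. Here `v r : Fin d` are zero-based. -/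
def diagonalIdeal (K : Type*) [Field K] {d k : ℕ} (i : Fin (k + 1) → Fin (d + 1)) :
    Ideal (MvPolynomial (Fin (d + 1)) K) :=
  Ideal.span
    ({g | ∃ v r : Fin d, (∃ j : Fin (k + 1), (v : ℕ) + 1 ≤ i j ∧ (i j : ℕ) < r + 1) ∧
        g = hankel K d 0 v * hankel K d 1 r} ∪
     {g | ∃ v r : Fin d, (∃ j : Fin k, (i j.castSucc : ℕ) < v + 1 ∧ v < r ∧
          (r : ℕ) + 1 ≤ i j.succ) ∧
        g = hankel K d 1 v * hankel K d 0 r})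

end RNC

end

/-!
Call `(∑ αᵢ, ∑ i αᵢ)` the bidegree of the monomial `t ^ α`. The ideal `P` of the curve is spanned by
the differences of monomials of the same bidegree, so the standard monomials of a monomial initial
ideal of `P` (the monomials outside the ideal) form a section of the bidegree: they contain exactly
one monomial of each bidegree that occurs. This is shown for term orders in
`isSection_standard_termInitialIdeal` and for weights in `isSection_standard_weightInitialIdeal`.

For a set `V` of vertices containing `0` and `d`, the ideals in the first two conditions are both
equal to the ideal `quadricIdeal K V` generated by the products `t_a t_b`, `a ≤ b`, such that either
some vertex lies strictly between `a` and `b`, or no vertex lies in `[a, b]`. Its standard monomials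
are called admissible; they are the products `t_u ^ a t_v ^ c` and `t_q t_u ^ a t_v ^ c` with
consecutive vertices `u < v` and `u < q < v`.

*The quadratic ideal is initial.* An admissible monomial is determined by its bidegree
(`Admissible.eq_of_bideg_eq`). A weight function that is strictly concave between consecutive
vertices and strictly convex across the inner ones decreases when a forbidden pair is moved inwards (if
a vertex separates it) or outwards (if not), so the admissible monomials are exactly those of least weight of their bidegrees
(`Admissible.eq_or_weight_lt`).

*The quadratic ideal is Cohen-Macaulay.* Colour the vertices alternately with two colours, and let
the variables of `K[X][Y]` act on the quotient as the sums of the vertex variables of each colour.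
The quotient is a free module of rank `d` over `K[X][Y]`: it is spanned by `1` and all variables but
those of the first two vertices (`span_basisFamily`), and their independence is tested on the edges
`u, v`, thickened by infinitesimals for the variables in between (`linearIndependent_basisFamily`).
A finite free algebra over `K[X][Y]` is Cohen-Macaulay (`isCohenMacaulay_of_free`), as a regular
sequence of length two in a maximal ideal of `K[X][Y]` stays regular.

*Conversely*, let the quotient by a monomial ideal `I` be Cohen-Macaulay, and let the standard
monomials form a section. Then `I` contains no power of the product of some two variables, hence
the quotient has dimension at least two at the origin. Depth two excludes associated primes modulo
which the maximal ideal is principal (`false_of_regular_pair`), and for monomial ideals this means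
that each standard monomial may be multiplied by arbitrary powers of two suitable variables without
becoming nonstandard (`exists_ne_forall_mem_standard`). Call `u < v` an edge if all monomials in
`t_u` and `t_v` are standard. By uniqueness in each bidegree, edges have disjoint interiors, and the
variables free along an edge are distinct modulo `v - u`. Reducing the remaining indices modulo the
lengths of their edges therefore permutes them (`IsUnmixedSection.exists_perm`); since no variable
lies to the right of its edge (`IsUnmixedSection.lt_right`), the permutation decreases no index and
is the identity. So each remaining variable lies inside its edge, which makes all standard monomials
admissible for the set of ends of the edges (`IsUnmixedSection.admissible`). Both sets contain one
monomial of each bidegree, hence they agree, and `I` is the quadratic ideal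
(`exists_eq_quadricIdeal`).
-/

noncomputable section

namespace RNC

section
open MvPolynomial

/-! ### The bidegree and the curve ideal -/

/-- The bidegree `(∑ αᵢ, ∑ i αᵢ)` of an exponent vector. Two monomials have the same image in the
coordinate ring of the rational normal curve exactly if their bidegrees agree. -/
def bideg (d : ℕ) : (Fin (d + 1) →₀ ℕ) →+ ℕ × ℕ :=
  AddMonoidHom.prod Finsupp.degree (Finsupp.weight fun i : Fin (d + 1) => (i : ℕ))

lemma bideg_fst {d : ℕ} (α : Fin (d + 1) →₀ ℕ) : (bideg d α).1 = ∑ i, α i := by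
  simp [bideg, Finsupp.degree_eq_sum]

lemma bideg_snd {d : ℕ} (α : Fin (d + 1) →₀ ℕ) : (bideg d α).2 = ∑ i, α i * (i : ℕ) := by
  simp [bideg, Finsupp.weight_eq_sum]

@[simp] lemma bideg_single {d : ℕ} (i : Fin (d + 1)) (n : ℕ) :
    bideg d (Finsupp.single i n) = (n, n * i) := by
  simp [bideg, Finsupp.weight_single]

lemma bideg_snd_le {d : ℕ} (α : Fin (d + 1) →₀ ℕ) : (bideg d α).2 ≤ d * (bideg d α).1 := by
  rw [bideg_fst, bideg_snd, Finset.mul_sum]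
  exact Finset.sum_le_sum fun i _ => by rw [mul_comm]; exact Nat.mul_le_mul_right _ (by omega)

/-- The map parametrizing the curve sends a monomial to the monomial `x ^ (d n - m) y ^ m`, where
`(n, m)` is its bidegree. -/
lemma aeval_curve_monomial {K : Type*} [Field K] {d : ℕ} (α : Fin (d + 1) →₀ ℕ) (c : K) :
    MvPolynomial.aeval (R := K) (fun i : Fin (d + 1) =>
      (X 0 ^ (d - (i : ℕ)) * X 1 ^ (i : ℕ) : MvPolynomial (Fin 2) K)) (monomial α c) =
    monomial (Finsupp.single 0 (d * (bideg d α).1 - (bideg d α).2) +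
      Finsupp.single 1 (bideg d α).2) c := by
  have key : α.prod (fun i k => (X 0 ^ (d - (i : ℕ)) * X 1 ^ (i : ℕ) : MvPolynomial (Fin 2) K) ^ k)
      = X 0 ^ (d * (bideg d α).1 - (bideg d α).2) * X 1 ^ (bideg d α).2 := by
    induction α using Finsupp.induction_linear with
    | zero => simp
    | add f g hf hg =>
      rw [Finsupp.prod_add_index' (by simp) (by intros; rw [pow_add]), hf, hg, map_add,
        Prod.fst_add, Prod.snd_add]
      have h1 := bideg_snd_le f
      have h2 := bideg_snd_le g
      have : d * ((bideg d f).1 + (bideg d g).1) - ((bideg d f).2 + (bideg d g).2) =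
        (d * (bideg d f).1 - (bideg d f).2) + (d * (bideg d g).1 - (bideg d g).2) := by
        rw [mul_add]; omega
      rw [this, pow_add, pow_add]; ring
    | single i n =>
      rw [Finsupp.prod_single_index (by simp), bideg_single, mul_pow, ← pow_mul, ← pow_mul]
      congr 2
      · rw [Nat.sub_mul, mul_comm n]
      · ring
  rw [aeval_monomial, key, X_pow_eq_monomial, X_pow_eq_monomial, monomial_mul,
    MvPolynomial.algebraMap_eq, C_mul_monomial]
  simp

/-- For elements of the curve ideal, the coefficients of the monomials of a given bidegree sum to
zero. -/
lemma sum_coeff_eq_zero_of_mem_curveIdeal {K : Type*} [Field K] {d : ℕ} (hd : 0 < d)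
    {f : MvPolynomial (Fin (d + 1)) K} (hf : f ∈ curveIdeal K d) (c : ℕ × ℕ) :
    ∑ α ∈ f.support with bideg d α = c, f.coeff α = 0 := by
  by_cases hc : c.2 ≤ d * c.1
  swap
  · refine Finset.sum_eq_zero fun α hα => ?_
    rw [Finset.mem_filter] at hα
    exact absurd (hα.2 ▸ bideg_snd_le α) hc
  rw [curveIdeal, RingHom.mem_ker] at hf
  have h := congrArg (coeff (Finsupp.single 0 (d * c.1 - c.2) + Finsupp.single 1 c.2)) hf
  conv_lhs at h => rw [f.as_sum]
  have key : ∀ α : Fin (d + 1) →₀ ℕ,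
      (Finsupp.single (0 : Fin 2) (d * (bideg d α).1 - (bideg d α).2) +
        Finsupp.single 1 (bideg d α).2 = Finsupp.single 0 (d * c.1 - c.2) + Finsupp.single 1 c.2) =
      (bideg d α = c) := by
    intro α
    refine propext ⟨fun h => ?_, fun h => by rw [h]⟩
    have h0 := DFunLike.congr_fun h 0
    have h1 := DFunLike.congr_fun h 1
    simp only [Finsupp.add_apply, Finsupp.single_eq_same, ne_eq, zero_ne_one, one_ne_zero,
      not_false_eq_true, Finsupp.single_eq_of_ne, add_zero, zero_add] at h0 h1
    have h2 := bideg_snd_le α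
    refine Prod.ext (Nat.eq_of_mul_eq_mul_left hd ?_) h1
    omega
  rw [map_sum, coeff_sum] at h
  simp_rw [aeval_curve_monomial, coeff_monomial, key] at h
  rw [Finset.sum_filter]
  simpa using h

/-- The difference of two monomials of the same bidegree vanishes on the curve. -/
lemma monomial_sub_mem_curveIdeal (K : Type*) [Field K] {d : ℕ} {α β : Fin (d + 1) →₀ ℕ}
    (h : bideg d α = bideg d β) :
    (monomial α 1 - monomial β 1 : MvPolynomial (Fin (d + 1)) K) ∈ curveIdeal K d := by
  rw [curveIdeal, RingHom.mem_ker, map_sub, aeval_curve_monomial, aeval_curve_monomial, h, sub_self]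

/-- Each monomial of an element of the curve ideal has a companion of the same bidegree. -/
lemma exists_ne_mem_support_of_mem_curveIdeal {K : Type*} [Field K] {d : ℕ} (hd : 0 < d)
    {f : MvPolynomial (Fin (d + 1)) K} (hf : f ∈ curveIdeal K d) {α : Fin (d + 1) →₀ ℕ}
    (hα : α ∈ f.support) : ∃ β ∈ f.support, β ≠ α ∧ bideg d β = bideg d α := by
  by_contra! hcon
  have h := sum_coeff_eq_zero_of_mem_curveIdeal hd hf (bideg d α)
  rw [Finset.sum_eq_single α] at h
  · exact (mem_support_iff.1 hα) h
  · intro β hβ hne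
    rw [Finset.mem_filter] at hβ
    exact absurd hβ.2 (hcon β hβ.1 hne)
  · intro hn
    exact absurd (by simpa using hα) hn

/-! ### Monomial ideals and their standard monomials -/

/-- The exponents of the standard monomials of `I`, i.e. of the monomials outside `I`. -/
def standard {σ K : Type*} [Field K] (I : Ideal (MvPolynomial σ K)) : Set (σ →₀ ℕ) :=
  {α | monomial α (1 : K) ∉ I}

lemma standard_of_add {σ K : Type*} [Field K] {I : Ideal (MvPolynomial σ K)} {α β : σ →₀ ℕ}
    (h : α + β ∈ standard I) : α ∈ standard I := by
  intro hα
  apply h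
  have : (monomial (α + β) 1 : MvPolynomial σ K) = monomial α 1 * monomial β 1 := by
    rw [monomial_mul, one_mul]
  rw [this]
  exact I.mul_mem_right _ hα

lemma monomial_mem_of_monomial_one_mem {σ K : Type*} [Field K] {I : Ideal (MvPolynomial σ K)}
    {α : σ →₀ ℕ}
    (c : K) (h : monomial α (1 : K) ∈ I) : monomial α c ∈ I := by
  have : monomial α c = C c * monomial α (1 : K) := by rw [C_mul_monomial, mul_one]
  rw [this]
  exact I.mul_mem_left _ h

lemma mem_of_forall_support {σ K : Type*} [Field K] {I : Ideal (MvPolynomial σ K)}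
    {f : MvPolynomial σ K} (h : ∀ α ∈ f.support, monomial α (1 : K) ∈ I) : f ∈ I := by
  rw [f.as_sum]
  exact I.sum_mem fun α hα => monomial_mem_of_monomial_one_mem _ (h α hα)

/-- An ideal is monomial if and only if it contains all monomials of each of its elements. -/
lemma IsMonomialIdeal.mem_iff {σ K : Type*} [Field K] {I : Ideal (MvPolynomial σ K)}
    (hI : IsMonomialIdeal I) {f : MvPolynomial σ K} :
    f ∈ I ↔ ∀ α ∈ f.support, monomial α (1 : K) ∈ I := by
  refine ⟨fun hf α hα => ?_, mem_of_forall_support⟩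
  obtain ⟨A, rfl⟩ := hI
  classical
  rw [mem_ideal_span_monomial_image] at hf ⊢
  intro β hβ
  rw [support_monomial, if_neg one_ne_zero, Finset.mem_singleton] at hβ
  exact hβ ▸ hf α hα

lemma IsMonomialIdeal.le_of_standard_subset {σ K : Type*} [Field K] {I J : Ideal (MvPolynomial σ K)}
    (hI : IsMonomialIdeal I) (h : standard J ⊆ standard I) : I ≤ J := by
  intro f hf
  refine mem_of_forall_support fun α hα => ?_
  by_contra hc
  exact h hc (hI.mem_iff.1 hf α hα)

/-- A set of exponent vectors is a section of the bidegree if it contains exactly one element of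
each nonempty fibre. -/
def IsSection {d : ℕ} (B : Set (Fin (d + 1) →₀ ℕ)) : Prop :=
  (∀ α ∈ B, ∀ β ∈ B, bideg d α = bideg d β → α = β) ∧ ∀ α, ∃ β ∈ B, bideg d β = bideg d α

/-- Every pair `(n, m)` with `m ≤ d n` is a bidegree. -/
lemma exists_bideg_eq {d : ℕ} (n m : ℕ) (h : m ≤ d * n) : ∃ α, bideg d α = (n, m) := by
  induction n generalizing m with
  | zero => exact ⟨0, by rw [map_zero, Nat.le_zero.1 h]; rfl⟩
  | succ n ih =>
    by_cases hm : m ≤ d * n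
    · obtain ⟨α, hα⟩ := ih m hm
      exact ⟨α + Finsupp.single 0 1, by simp [hα]⟩
    · obtain ⟨α, hα⟩ := ih (d * n) le_rfl
      rw [mul_add] at h
      refine ⟨α + Finsupp.single ⟨m - d * n, by omega⟩ 1, ?_⟩
      rw [map_add, hα, bideg_single]
      ext
      · simp
      · simp; omega

/-! ### Initial ideals of the curve -/

lemma IsMonomialIdeal.termInitialIdeal {σ K : Type*} [Field K] (τ : MonomialOrder σ)
    (I : Ideal (MvPolynomial σ K)) : IsMonomialIdeal (termInitialIdeal τ I) := by
  refine ⟨{α | ∃ f ∈ I, f ≠ 0 ∧ α = τ.degree f}, ?_⟩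
  rw [RNC.termInitialIdeal]
  congr 1
  ext g
  constructor
  · rintro ⟨f, hf, h0, rfl⟩
    exact ⟨_, ⟨f, hf, h0, rfl⟩, rfl⟩
  · rintro ⟨_, ⟨f, hf, h0, rfl⟩, rfl⟩
    exact ⟨f, hf, h0, rfl⟩

open MonomialOrder in
/-- A monomial is in the initial ideal of the curve exactly if it is not the smallest monomial of
its bidegree. -/
lemma monomial_mem_termInitialIdeal_iff {K : Type*} [Field K] {d : ℕ} (hd : 0 < d)
    (τ : MonomialOrder (Fin (d + 1))) (α : Fin (d + 1) →₀ ℕ) :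
    monomial α (1 : K) ∈ RNC.termInitialIdeal τ (curveIdeal K d) ↔
      ∃ β, bideg d β = bideg d α ∧ β ≺[τ] α := by
  have hle : ∀ {f : MvPolynomial (Fin (d + 1)) K} {β}, β ∈ f.support → β ≼[τ] τ.degree f :=
    fun h => τ.le_degree h
  constructor
  · intro h
    have h' : monomial α (1 : K) ∈ Ideal.span ((fun s => monomial s (1 : K)) ''
        {α | ∃ f ∈ curveIdeal K d, f ≠ 0 ∧ α = τ.degree f}) := by
      refine Ideal.span_mono ?_ h
      rintro _ ⟨f, hf, h0, rfl⟩
      exact ⟨_, ⟨f, hf, h0, rfl⟩, rfl⟩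
    rw [mem_ideal_span_monomial_image] at h'
    obtain ⟨_, ⟨f, hf, h0, rfl⟩, hle'⟩ := h' α (by simp)
    obtain ⟨γ, rfl⟩ := exists_add_of_le hle'
    obtain ⟨β, hβ, hne, hb⟩ :=
      exists_ne_mem_support_of_mem_curveIdeal hd hf (τ.degree_mem_support h0)
    refine ⟨β + γ, by rw [map_add, map_add, hb], ?_⟩
    rw [map_add, map_add]
    exact add_lt_add_left (lt_of_le_of_ne (hle hβ) fun h => hne (τ.toSyn.injective h)) _
  · rintro ⟨β, hb, hlt⟩
    refine Ideal.subset_span ⟨monomial α 1 - monomial β 1,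
      monomial_sub_mem_curveIdeal K hb.symm, ?_, ?_⟩
    · intro h0
      have hne : α ≠ β := by rintro rfl; exact lt_irrefl _ hlt
      have := congrArg (coeff α) h0
      simp [coeff_monomial, hne.symm] at this
    · congr 1
      classical
      rw [τ.degree_sub_of_lt, τ.degree_monomial, if_neg one_ne_zero]
      rwa [τ.degree_monomial, τ.degree_monomial, if_neg one_ne_zero, if_neg one_ne_zero]

lemma isSection_standard_termInitialIdeal {K : Type*} [Field K] {d : ℕ} (hd : 0 < d)
    (τ : MonomialOrder (Fin (d + 1))) :
    IsSection (standard (RNC.termInitialIdeal τ (curveIdeal K d))) := by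
  have hst : ∀ α, α ∈ standard (RNC.termInitialIdeal τ (curveIdeal K d)) ↔
      ∀ β, bideg d β = bideg d α → τ.toSyn α ≤ τ.toSyn β := by
    intro α
    rw [standard, Set.mem_ofPred_eq, monomial_mem_termInitialIdeal_iff hd]
    push Not
    rfl
  constructor
  · intro α hα β hβ h
    exact τ.toSyn.injective
      (le_antisymm ((hst α).1 hα β h.symm) ((hst β).1 hβ α h))
  · intro α
    obtain ⟨β, hβ, hmin⟩ := (InvImage.wf τ.toSyn τ.wellFoundedLT_syn.wf).has_min
      {β | bideg d β = bideg d α} ⟨α, rfl⟩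
    exact ⟨β, (hst β).2 fun γ hγ => not_lt.1 (hmin γ (hγ.trans hβ)), hβ⟩

lemma support_initialForm {σ K : Type*} [Field K] (a : σ → ℚ) (f : MvPolynomial σ K)
    (α : σ →₀ ℕ) : α ∈ (initialForm a f).support ↔
      α ∈ f.support ∧ ∀ β ∈ f.support, Finsupp.weight a β ≤ Finsupp.weight a α := by
  classical
  rw [mem_support_iff, initialForm, coeff_sum]
  simp only [coeff_monomial, Finset.sum_ite_eq', Finset.mem_filter, mem_support_iff]
  split_ifs with h <;> simp_all

/-- A monomial of the initial form of an element of the curve ideal is not the unique one of least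
weight among those of its bidegree. -/
lemma exists_of_mem_support_initialForm {K : Type*} [Field K] {d : ℕ} (hd : 0 < d)
    (a : Fin (d + 1) → ℚ) {f : MvPolynomial (Fin (d + 1)) K} (hf : f ∈ curveIdeal K d)
    {α : Fin (d + 1) →₀ ℕ} (hα : α ∈ (initialForm a f).support) :
    ∃ β, β ≠ α ∧ bideg d β = bideg d α ∧ Finsupp.weight a β ≤ Finsupp.weight a α := by
  rw [support_initialForm] at hα
  obtain ⟨β, hβ, hne, hb⟩ := exists_ne_mem_support_of_mem_curveIdeal hd hf hα.1
  exact ⟨β, hne, hb, hα.2 β hβ⟩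

/-- The initial form of a binomial contains its monomial of larger weight. -/
lemma mem_support_initialForm_binomial {σ K : Type*} [Field K] (a : σ → ℚ) {α β : σ →₀ ℕ}
    (hne : β ≠ α) (hw : Finsupp.weight a β ≤ Finsupp.weight a α) :
    α ∈ (initialForm a (monomial α 1 - monomial β 1 : MvPolynomial σ K)).support := by
  classical
  rw [support_initialForm]
  constructor
  · simp [coeff_monomial, hne]
  · intro γ hγ
    rcases Finset.mem_union.1 (support_sub _ _ _ hγ) with h | h
    · rw [support_monomial, if_neg one_ne_zero, Finset.mem_singleton] at h
      rw [h]
    · rw [support_monomial, if_neg one_ne_zero, Finset.mem_singleton] at h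
      rwa [h]

open Classical in
/-- The functional adding up the coefficients of the monomials of bidegree `c` and weight `w`. -/
def fibreSum (K : Type*) [Field K] {d : ℕ} (a : Fin (d + 1) → ℚ) (c : ℕ × ℕ) (w : ℚ) :
    MvPolynomial (Fin (d + 1)) K →ₗ[K] K :=
  (basisMonomials (Fin (d + 1)) K).constr K
    fun α => if bideg d α = c ∧ Finsupp.weight a α = w then 1 else 0

open Classical in
lemma fibreSum_monomial {K : Type*} [Field K] {d : ℕ} (a : Fin (d + 1) → ℚ) (c : ℕ × ℕ) (w : ℚ)
    (α : Fin (d + 1) →₀ ℕ) (k : K) : fibreSum K a c w (monomial α k) =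
      if bideg d α = c ∧ Finsupp.weight a α = w then k else 0 := by
  have : monomial α k = k • basisMonomials (Fin (d + 1)) K α := by
    rw [coe_basisMonomials, smul_monomial, smul_eq_mul, mul_one]
  rw [this, map_smul, fibreSum, Module.Basis.constr_basis]
  simp

/-- Adding up the coefficients over the monomials of least weight of a given bidegree gives zero
for all elements of the initial ideal of the curve. -/
lemma fibreSum_eq_zero_of_mem {K : Type*} [Field K] {d : ℕ} (hd : 0 < d)
    (a : Fin (d + 1) → ℚ) {g : MvPolynomial (Fin (d + 1)) K}
    (hg : g ∈ weightInitialIdeal a (curveIdeal K d)) : ∀ (c : ℕ × ℕ) (w : ℚ),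
    (∀ α, bideg d α = c → w ≤ Finsupp.weight a α) → fibreSum K a c w g = 0 := by
  classical
  induction hg using Submodule.span_induction with
  | mem g hg =>
    intro c w hw
    obtain ⟨f, hf, -, rfl⟩ := hg
    by_cases hex : ∃ α ∈ (initialForm a f).support, bideg d α = c ∧ Finsupp.weight a α = w
    · obtain ⟨α, hα, rfl, rfl⟩ := hex
      rw [support_initialForm] at hα
      rw [← sum_coeff_eq_zero_of_mem_curveIdeal hd hf (bideg d α), initialForm, map_sum]
      simp_rw [fibreSum_monomial]
      rw [← Finset.sum_filter, Finset.filter_filter]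
      refine Finset.sum_congr (Finset.filter_congr fun β hβ => ?_) fun _ _ => rfl
      refine ⟨fun h => h.2.1, fun h => ?_⟩
      have hβα : Finsupp.weight a β = Finsupp.weight a α := le_antisymm (hα.2 β hβ) (hw β h)
      exact ⟨fun γ hγ => hβα ▸ hα.2 γ hγ, h, hβα⟩
    · push Not at hex
      rw [(initialForm a f).as_sum, map_sum]
      refine Finset.sum_eq_zero fun α hα => ?_
      rw [fibreSum_monomial, if_neg fun h => hex α hα h.1 h.2]
  | zero => simp
  | add x y _ _ hx hy => intro c w hw; rw [map_add, hx c w hw, hy c w hw, add_zero]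
  | smul p x _ hx =>
    intro c w hw
    rw [smul_eq_mul, p.as_sum, Finset.sum_mul, map_sum]
    refine Finset.sum_eq_zero fun γ _ => ?_
    by_cases hex : ∃ β, bideg d β + bideg d γ = c ∧ Finsupp.weight a β + Finsupp.weight a γ = w
    · obtain ⟨β, rfl, rfl⟩ := hex
      have hx' := hx (bideg d β) (Finsupp.weight a β) fun α hα => by
        have := hw (α + γ) (by rw [map_add, hα])
        rw [map_add] at this
        linarith
      have : ∀ y : MvPolynomial (Fin (d + 1)) K,
          fibreSum K a (bideg d β + bideg d γ) (Finsupp.weight a β + Finsupp.weight a γ)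
            (monomial γ (coeff γ p) * y) =
          coeff γ p * fibreSum K a (bideg d β) (Finsupp.weight a β) y := by
        intro y
        rw [y.as_sum, Finset.mul_sum, map_sum, map_sum, Finset.mul_sum]
        refine Finset.sum_congr rfl fun δ _ => ?_
        simp only [monomial_mul, fibreSum_monomial, add_comm γ δ, map_add, add_left_inj, mul_ite,
          mul_zero]
      rw [this, hx', mul_zero]
    · push Not at hex
      rw [x.as_sum, Finset.mul_sum, map_sum]
      refine Finset.sum_eq_zero fun δ _ => ?_
      rw [monomial_mul, fibreSum_monomial, if_neg]
      rw [add_comm γ δ, map_add, map_add]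
      exact fun h => hex δ h.1 h.2

lemma finite_bideg_fibre {d : ℕ} (c : ℕ × ℕ) : {α | bideg d α = c}.Finite :=
  (Finsupp.finite_of_degree_eq c.1).subset fun α (hα : bideg d α = c) => by
    rw [← hα]; rfl

/-- If `in_a(P)` is a monomial ideal, then of two monomials of the same bidegree the one of larger
weight lies in it, while one of least weight does not. -/
lemma isSection_standard_weightInitialIdeal {K : Type*} [Field K] {d : ℕ} (hd : 0 < d)
    (a : Fin (d + 1) → ℚ) (hI : IsMonomialIdeal (weightInitialIdeal a (curveIdeal K d))) :
    IsSection (standard (weightInitialIdeal a (curveIdeal K d))) := by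
  have hmem : ∀ α β, β ≠ α → bideg d β = bideg d α → Finsupp.weight a β ≤ Finsupp.weight a α →
      monomial α (1 : K) ∈ weightInitialIdeal a (curveIdeal K d) := by
    intro α β hne hb hw
    have hs := mem_support_initialForm_binomial (K := K) a hne hw
    refine hI.mem_iff.1 (Ideal.subset_span ⟨_, monomial_sub_mem_curveIdeal K hb.symm, ?_, rfl⟩) α hs
    intro h0
    rw [h0, support_initialForm] at hs
    simp at hs
  constructor
  · intro α hα β hβ h
    by_contra hne
    rcases le_total (Finsupp.weight a α) (Finsupp.weight a β) with hw | hw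
    · exact hβ (hmem β α hne h hw)
    · exact hα (hmem α β (Ne.symm hne) h.symm hw)
  · intro α
    obtain ⟨β, hβ, hmin⟩ := Set.exists_min_image {β | bideg d β = bideg d α}
      (Finsupp.weight a) (finite_bideg_fibre _) ⟨α, rfl⟩
    refine ⟨β, fun h => ?_, hβ⟩
    have := fibreSum_eq_zero_of_mem hd a h (bideg d α) (Finsupp.weight a β) hmin
    rw [fibreSum_monomial, if_pos ⟨hβ, rfl⟩] at this
    exact one_ne_zero this

/-! ### The quadratic monomial ideal of a set of vertices -/

/-- Let `V` be a set of vertices in `{0, …, d}`. A pair `a ≤ b` is forbidden if some vertex lies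
strictly between `a` and `b`, or if both lie strictly inside the same interval between two
consecutive vertices (that is, no vertex lies in `[a, b]`). -/
def Forbidden {d : ℕ} (V : Set (Fin (d + 1))) (a b : Fin (d + 1)) : Prop :=
  a ≤ b ∧ ((∃ w ∈ V, a < w ∧ w < b) ∨ ∀ w ∈ V, ¬ (a ≤ w ∧ w ≤ b))

/-- The ideal generated by the products `t_a t_b` for the forbidden pairs `a ≤ b`. -/
def quadricIdeal (K : Type*) [Field K] {d : ℕ} (V : Set (Fin (d + 1))) :
    Ideal (MvPolynomial (Fin (d + 1)) K) :=
  Ideal.span {g | ∃ a b, Forbidden V a b ∧ g = X a * X b}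

/-- The exponent vectors of the monomials divisible by no `t_a t_b` with `a ≤ b` forbidden. -/
def Admissible {d : ℕ} (V : Set (Fin (d + 1))) (α : Fin (d + 1) →₀ ℕ) : Prop :=
  ∀ a b, Forbidden V a b → ¬ Finsupp.single a 1 + Finsupp.single b 1 ≤ α

lemma quadricIdeal_eq_span_monomial (K : Type*) [Field K] {d : ℕ} (V : Set (Fin (d + 1))) :
    quadricIdeal K V = Ideal.span ((fun α => monomial α (1 : K)) ''
      {α | ∃ a b, Forbidden V a b ∧ α = Finsupp.single a 1 + Finsupp.single b 1}) := by
  rw [quadricIdeal]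
  congr 1
  ext g
  simp only [Set.mem_image, Set.mem_ofPred_eq]
  constructor
  · rintro ⟨a, b, h, rfl⟩
    exact ⟨_, ⟨a, b, h, rfl⟩, by rw [X, X, monomial_mul, one_mul]⟩
  · rintro ⟨_, ⟨a, b, h, rfl⟩, rfl⟩
    exact ⟨a, b, h, by rw [X, X, monomial_mul, one_mul]⟩

lemma isMonomialIdeal_quadricIdeal (K : Type*) [Field K] {d : ℕ} (V : Set (Fin (d + 1))) :
    IsMonomialIdeal (quadricIdeal K V) :=
  ⟨_, quadricIdeal_eq_span_monomial K V⟩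

lemma mem_standard_quadricIdeal {K : Type*} [Field K] {d : ℕ} {V : Set (Fin (d + 1))}
    {α : Fin (d + 1) →₀ ℕ} : α ∈ standard (quadricIdeal K V) ↔ Admissible V α := by
  classical
  rw [standard, Set.mem_ofPred_eq, quadricIdeal_eq_span_monomial, mem_ideal_span_monomial_image,
    support_monomial, if_neg one_ne_zero, Admissible]
  simp only [Finset.mem_singleton, forall_eq]
  constructor
  · exact fun h a b hab hle => h ⟨_, ⟨a, b, hab, rfl⟩, hle⟩
  · rintro h ⟨_, ⟨a, b, hab, rfl⟩, hle⟩
    exact h a b hab hle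

lemma single_add_single_le {σ : Type*} {a b : σ} (hab : a ≠ b) {α : σ →₀ ℕ} (ha : α a ≠ 0)
    (hb : α b ≠ 0) : Finsupp.single a 1 + Finsupp.single b 1 ≤ α := by
  classical
  intro c
  simp only [Finsupp.add_apply, Finsupp.single_apply]
  split_ifs with h1 h2 h2
  · exact absurd (h1.trans h2.symm) hab
  · subst h1; omega
  · subst h2; omega
  · omega

lemma single_add_self_le {σ : Type*} {a : σ} {α : σ →₀ ℕ} (ha : 2 ≤ α a) :
    Finsupp.single a 1 + Finsupp.single a 1 ≤ α := by
  rw [← Finsupp.single_add, Finsupp.single_le_iff]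
  exact ha

section
variable {d : ℕ} {V : Set (Fin (d + 1))} {α β : Fin (d + 1) →₀ ℕ}

lemma Admissible.notMem_of_lt_of_lt (h : Admissible V α) {a b w : Fin (d + 1)}
    (ha : α a ≠ 0) (hb : α b ≠ 0) (haw : a < w) (hwb : w < b) : w ∉ V :=
  fun hw => h a b ⟨(haw.trans hwb).le, Or.inl ⟨w, hw, haw, hwb⟩⟩
    (single_add_single_le (haw.trans hwb).ne ha hb)

lemma Admissible.mem_or_mem (h : Admissible V α) {a b : Fin (d + 1)} (ha : α a ≠ 0) (hb : α b ≠ 0)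
    (hab : a < b) : a ∈ V ∨ b ∈ V := by
  by_contra! hc
  refine h a b ⟨hab.le, Or.inr fun w hw hle => ?_⟩ (single_add_single_le hab.ne ha hb)
  refine h.notMem_of_lt_of_lt ha hb (lt_of_le_of_ne hle.1 ?_) (lt_of_le_of_ne hle.2 ?_) hw
  · rintro rfl; exact hc.1 hw
  · rintro rfl; exact hc.2 hw

lemma Admissible.eq_one (h : Admissible V α) {a : Fin (d + 1)} (ha : α a ≠ 0) (hV : a ∉ V) :
    α a = 1 := by
  by_contra hc
  refine h a a ⟨le_rfl, Or.inr fun w hw hle => hV ?_⟩ (single_add_self_le (by omega))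
  rwa [← le_antisymm hle.1 hle.2] at hw

lemma Admissible.mono (h : Admissible V α) (hle : β ≤ α) : Admissible V β :=
  fun a b hab hc => h a b hab (hc.trans hle)

lemma bideg_snd_le_of_forall_le {b : Fin (d + 1)} (h : ∀ i, α i ≠ 0 → i ≤ b) :
    (bideg d α).2 ≤ (bideg d α).1 * b := by
  rw [bideg_fst, bideg_snd, Finset.sum_mul]
  refine Finset.sum_le_sum fun i _ => ?_
  by_cases hi : α i = 0
  · simp [hi]
  · exact Nat.mul_le_mul_left _ (h i hi)

lemma le_bideg_snd_of_forall_le {a : Fin (d + 1)} (h : ∀ i, α i ≠ 0 → a ≤ i) :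
    (bideg d α).1 * a ≤ (bideg d α).2 := by
  rw [bideg_fst, bideg_snd, Finset.sum_mul]
  refine Finset.sum_le_sum fun i _ => ?_
  by_cases hi : α i = 0
  · simp [hi]
  · exact Nat.mul_le_mul_left _ (h i hi)

lemma eq_zero_of_bideg_fst (h : (bideg d α).1 = 0) : α = 0 := by
  rw [bideg_fst, Finset.sum_eq_zero_iff] at h
  ext i
  simpa using h i (Finset.mem_univ i)

/-- Two admissible monomials different from `1` and without common variables have different
bidegrees. The smallest variable `t_a` involved is assumed to occur in the first one. -/
lemma Admissible.bideg_ne (hα : Admissible V α) (hβ : Admissible V β)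
    (hdisj : ∀ i, α i ≠ 0 → β i = 0) {a a' : Fin (d + 1)} (ha : α a ≠ 0)
    (ha' : β a' ≠ 0) (hmin' : ∀ i, β i ≠ 0 → a' ≤ i) (hmin : ∀ i, α i ≠ 0 → a ≤ i)
    (haa' : a < a') : bideg d α ≠ bideg d β := by
  classical
  intro hb
  have hmax : ∀ γ : Fin (d + 1) →₀ ℕ, ∀ c, γ c ≠ 0 → ∃ b, γ b ≠ 0 ∧ ∀ i, γ i ≠ 0 → i ≤ b := by
    intro γ c hc
    have hne : γ.support.Nonempty := ⟨c, Finsupp.mem_support_iff.2 hc⟩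
    exact ⟨γ.support.max' hne, Finsupp.mem_support_iff.1 (Finset.max'_mem _ hne),
      fun i hi => Finset.le_max' _ _ (Finsupp.mem_support_iff.2 hi)⟩
  obtain ⟨b, hαb, hbmax⟩ := hmax α a ha
  obtain ⟨b', hβb', hbmax'⟩ := hmax β a' ha'
  have hfst := congrArg Prod.fst hb
  have hsnd := congrArg Prod.snd hb
  have hne : ∀ {i j}, α i ≠ 0 → β j ≠ 0 → i ≠ j := by
    rintro i _ hi hj rfl
    exact hj (hdisj i hi)
  -- the averages of the indices agree, so the ranges of the indices overlap
  have hlt : a' < b := by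
    by_contra hc
    have hlt : b < a' := lt_of_le_of_ne (not_lt.1 hc) (hne hαb ha')
    have h1 := bideg_snd_le_of_forall_le hbmax
    have h2 := le_bideg_snd_of_forall_le hmin'
    have h3 : 0 < (bideg d β).1 := by
      rw [Nat.pos_iff_ne_zero]
      intro h0
      rw [eq_zero_of_bideg_fst h0] at ha'
      simp at ha'
    rw [hfst, hsnd] at h1
    have h4 : (bideg d β).1 * (b : ℕ) < (bideg d β).1 * (a' : ℕ) :=
      Nat.mul_lt_mul_of_pos_left hlt h3
    omega
  have ha'V : a' ∉ V := hα.notMem_of_lt_of_lt ha hαb haa' hlt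
  have hβa' := hβ.eq_one ha' ha'V
  have hle' : a' ≤ b' := hmin' _ hβb'
  have hdeg : 2 ≤ (bideg d α).1 := by
    rw [bideg_fst, ← Finset.add_sum_erase _ _ (Finset.mem_univ a)]
    have := Finset.single_le_sum (f := fun i => α i) (fun i _ => Nat.zero_le _)
      (Finset.mem_erase.2 ⟨(haa'.trans hlt).ne', Finset.mem_univ b⟩)
    omega
  rcases hle'.eq_or_lt with heq | hlt'
  · have : β = Finsupp.single a' 1 := by
      ext i
      by_cases hi : i = a'
      · rw [hi, hβa', Finsupp.single_eq_same]
      · rw [Finsupp.single_eq_of_ne hi]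
        by_contra hc
        exact hi (le_antisymm ((hbmax' i hc).trans heq.ge) (hmin' i hc))
    rw [this, bideg_single] at hfst
    simp only at hfst
    omega
  have hb'V : b' ∈ V := (hβ.mem_or_mem ha' hβb' hlt').resolve_left ha'V
  have hbb' : b < b' := by
    refine lt_of_le_of_ne (not_lt.1 fun hc => ?_) (hne hαb hβb')
    exact hα.notMem_of_lt_of_lt ha hαb (haa'.trans hlt') hc hb'V
  have hbV : b ∉ V := hβ.notMem_of_lt_of_lt ha' hβb' hlt hbb'
  have hαeq : α = Finsupp.single a (α a) + Finsupp.single b 1 := by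
    ext i
    rw [Finsupp.add_apply, Finsupp.single_apply, Finsupp.single_apply]
    by_cases hia : i = a
    · rw [hia, if_pos rfl, if_neg (haa'.trans hlt).ne', add_zero]
    by_cases hib : i = b
    · rw [hib, if_neg (haa'.trans hlt).ne, if_pos rfl, zero_add, hα.eq_one hαb hbV]
    rw [if_neg (Ne.symm hia), if_neg (Ne.symm hib), zero_add]
    by_contra hc
    have h1 : a < i := lt_of_le_of_ne (hmin i hc) (Ne.symm hia)
    have h2 : i < b := lt_of_le_of_ne (hbmax i hc) hib
    exact (hα.mem_or_mem hc hαb h2).elim (hα.notMem_of_lt_of_lt ha hαb h1 h2) hbV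
  have hβeq : β = Finsupp.single a' 1 + Finsupp.single b' (β b') := by
    ext i
    rw [Finsupp.add_apply, Finsupp.single_apply, Finsupp.single_apply]
    by_cases hia : i = a'
    · rw [hia, if_pos rfl, if_neg hlt'.ne', add_zero, hβa']
    by_cases hib : i = b'
    · rw [hib, if_neg hlt'.ne, if_pos rfl, zero_add]
    rw [if_neg (Ne.symm hia), if_neg (Ne.symm hib), zero_add]
    by_contra hc
    have h1 : a' < i := lt_of_le_of_ne (hmin' i hc) (Ne.symm hia)
    have h2 : i < b' := lt_of_le_of_ne (hbmax' i hc) hib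
    exact (hβ.mem_or_mem ha' hc h1).elim ha'V (hβ.notMem_of_lt_of_lt ha' hβb' h1 h2)
  rw [hαeq, hβeq] at hfst hsnd
  simp only [map_add, bideg_single, Prod.fst_add, Prod.snd_add, one_mul] at hfst hsnd
  -- `t_a ^ n t_b` and `t_a' t_b' ^ n` with `a < a' < b < b'` have different sums of indices
  have h5 : β b' = α a := by omega
  rw [h5] at hsnd
  have h6 : 1 ≤ α a := Nat.pos_of_ne_zero ha
  have h7 : (a : ℕ) < a' := haa'
  have h8 : (b : ℕ) < b' := hbb'
  have h9 : (a' : ℕ) < b := hlt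
  nlinarith

/-- An admissible monomial is determined by its bidegree: of two such monomials with the same
bidegree, common variables can be cancelled until `Admissible.bideg_ne` applies. -/
lemma Admissible.eq_of_bideg_eq (hα : Admissible V α) (hβ : Admissible V β)
    (h : bideg d α = bideg d β) : α = β := by
  classical
  induction hn : (bideg d α).1 generalizing α β with
  | zero =>
    rw [eq_zero_of_bideg_fst hn, eq_zero_of_bideg_fst (α := β) (by rw [← h, hn])]
  | succ n ih =>
    by_cases hdisj : ∀ i, α i ≠ 0 → β i = 0
    · exfalso
      have hmin : ∀ γ : Fin (d + 1) →₀ ℕ, (bideg d γ).1 = n + 1 →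
          ∃ b, γ b ≠ 0 ∧ ∀ i, γ i ≠ 0 → b ≤ i := by
        intro γ hγ
        have hne : γ.support.Nonempty := by
          rw [Finsupp.support_nonempty_iff]
          rintro rfl
          simp at hγ
        exact ⟨γ.support.min' hne, Finsupp.mem_support_iff.1 (Finset.min'_mem _ hne),
          fun i hi => Finset.min'_le _ _ (Finsupp.mem_support_iff.2 hi)⟩
      obtain ⟨a, ha, hamin⟩ := hmin α hn
      obtain ⟨a', ha', hamin'⟩ := hmin β (by rw [← h, hn])
      rcases lt_trichotomy a a' with hlt | rfl | hlt
      · exact hα.bideg_ne hβ hdisj ha ha' hamin' hamin hlt h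
      · exact ha' (hdisj _ ha)
      · refine hβ.bideg_ne hα (fun i hi => ?_) ha' ha hamin hamin' hlt h.symm
        by_contra hc
        exact hi (hdisj i hc)
    · push Not at hdisj
      obtain ⟨i, hi, hi'⟩ := hdisj
      have h1 : Finsupp.single i 1 ≤ α := by rw [Finsupp.single_le_iff]; omega
      have h2 : Finsupp.single i 1 ≤ β := by rw [Finsupp.single_le_iff]; omega
      obtain ⟨α', rfl⟩ := exists_add_of_le h1
      obtain ⟨β', rfl⟩ := exists_add_of_le h2
      rw [map_add, map_add, add_right_inj] at h
      rw [ih (hα.mono le_add_self) (hβ.mono le_add_self) h]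
      rw [map_add, bideg_single, Prod.fst_add] at hn
      simp only at hn
      omega

end

/-! ### Term orders refining a weight -/

/-- The exponent vectors, to be ordered by the weight `h` and then lexicographically. -/
def WeightLex {σ : Type*} (_ : σ → ℕ) : Type _ := σ →₀ ℕ

section
variable {σ : Type*} (h : σ → ℕ)

instance : AddCommMonoid (WeightLex h) := inferInstanceAs (AddCommMonoid (σ →₀ ℕ))

/-- The pair, ordered lexicographically, that consists of the weight and of the exponent vector. -/
def WeightLex.key : WeightLex h →+ Lex (ℕ × Lex (σ →₀ ℕ)) where
  toFun f := toLex (Finsupp.weight h (show σ →₀ ℕ from f), toLex (show σ →₀ ℕ from f))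
  map_zero' := by
    change toLex (Finsupp.weight h (0 : σ →₀ ℕ), toLex (0 : σ →₀ ℕ)) = 0
    rw [map_zero]; rfl
  map_add' f g := by
    change toLex (Finsupp.weight h ((show σ →₀ ℕ from f) + (show σ →₀ ℕ from g)), _) = _
    rw [map_add]; rfl

lemma WeightLex.key_injective : Function.Injective (WeightLex.key h) := fun _ _ hfg =>
  congrArg (fun p : Lex (ℕ × Lex (σ →₀ ℕ)) => ofLex (ofLex p).2) hfg

variable [LinearOrder σ]

instance : LinearOrder (WeightLex h) :=
  LinearOrder.lift' (WeightLex.key h) (WeightLex.key_injective h)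

instance : IsOrderedAddMonoid (WeightLex h) where
  add_le_add_left f g hfg k := by
    change WeightLex.key h (f + k) ≤ WeightLex.key h (g + k)
    rw [map_add, map_add]
    exact add_le_add_left (show WeightLex.key h f ≤ WeightLex.key h g from hfg) _

instance [WellFoundedGT σ] : WellFoundedLT (WeightLex h) :=
  ⟨InvImage.wf (WeightLex.key h) (wellFounded_lt (α := Lex (ℕ × Lex (σ →₀ ℕ))))⟩

/-- The term order comparing weights first and breaking ties lexicographically. -/
def weightOrder [WellFoundedGT σ] : MonomialOrder σ where
  syn := WeightLex h
  toSyn := { Equiv.refl (σ →₀ ℕ) with map_add' := fun _ _ => rfl }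
  toSyn_monotone := by
    intro f g hfg
    change WeightLex.key h f ≤ WeightLex.key h g
    obtain ⟨k, rfl⟩ := exists_add_of_le hfg
    refine Prod.Lex.toLex_mono (show ((_, _) : ℕ × Lex (σ →₀ ℕ)) ≤ (_, _) from ⟨?_, ?_⟩)
    · change Finsupp.weight h f ≤ Finsupp.weight h (f + k)
      rw [map_add]
      exact le_self_add
    · exact Finsupp.toLex_monotone le_self_add

lemma weightOrder_lt_of_weight_lt [WellFoundedGT σ] {f g : σ →₀ ℕ}
    (hfg : Finsupp.weight h f < Finsupp.weight h g) :
    (weightOrder h).toSyn f < (weightOrder h).toSyn g := by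
  change WeightLex.key h f < WeightLex.key h g
  exact Prod.Lex.toLex_lt_toLex.2 (Or.inl hfg)

end

/-! ### The weight attached to a set of vertices -/

section
variable {d : ℕ} (V : Set (Fin (d + 1)))

open Classical in
/-- The slope of the weight function on `[r, r + 1]`. It decreases strictly between consecutive
vertices and jumps upwards at each vertex by more than it decreases altogether. -/
def slope (r : ℕ) : ℕ :=
  (d + 1) * (Finset.univ.filter fun w : Fin (d + 1) => w ∈ V ∧ (w : ℕ) ≤ r).card + (d - r)

/-- The weight of the variable `t_s`: a function of `s` that is strictly concave between consecutive
vertices, with strict convexity across each inner vertex. -/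
def vertexWeight (s : ℕ) : ℕ := ∑ r ∈ Finset.range s, slope V r

variable {V}

lemma slope_lt_slope_of_mem {r s : ℕ} {w : Fin (d + 1)} (hw : w ∈ V) (hr : r < w)
    (hs : (w : ℕ) ≤ s) : slope V r < slope V s := by
  classical
  have hlt : (Finset.univ.filter fun v : Fin (d + 1) => v ∈ V ∧ (v : ℕ) ≤ r).card <
      (Finset.univ.filter fun v : Fin (d + 1) => v ∈ V ∧ (v : ℕ) ≤ s).card := by
    apply Finset.card_lt_card
    rw [Finset.ssubset_iff_of_subset]
    · exact ⟨w, by simp [hw, hs], by simp [hr]⟩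
    · intro v hv
      simp only [Finset.mem_filter, Finset.mem_univ, true_and] at hv ⊢
      exact ⟨hv.1, by omega⟩
  have := Nat.mul_le_mul_left (d + 1) (Nat.succ_le_of_lt hlt)
  rw [Nat.mul_succ] at this
  rw [slope, slope]
  convert lt_of_lt_of_le _ (this.trans (Nat.le_add_right _ (d - s))) using 1
  omega

lemma slope_lt_slope_of_forall_notMem {r s : ℕ} (hrs : r < s) (hs : s ≤ d)
    (h : ∀ w ∈ V, ¬ (r < w ∧ (w : ℕ) ≤ s)) : slope V s < slope V r := by
  classical
  rw [slope, slope]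
  have : (Finset.univ.filter fun v : Fin (d + 1) => v ∈ V ∧ (v : ℕ) ≤ s) =
      Finset.univ.filter fun v : Fin (d + 1) => v ∈ V ∧ (v : ℕ) ≤ r := by
    refine Finset.filter_congr fun v _ => ⟨fun hv => ⟨hv.1, ?_⟩, fun hv => ⟨hv.1, by omega⟩⟩
    by_contra hc
    exact h v hv.1 ⟨by omega, hv.2⟩
  rw [this]
  omega

/-- A forbidden pair can be replaced by a pair with the same sum and smaller weight: moving inwards
if a vertex separates the pair, and outwards otherwise. -/
lemma Forbidden.exists_vertexWeight_lt (h0 : 0 ∈ V) (hd : Fin.last d ∈ V) {a b : Fin (d + 1)}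
    (h : Forbidden V a b) : ∃ a' b' : Fin (d + 1), (a' : ℕ) + b' = a + b ∧
      vertexWeight V a' + vertexWeight V b' < vertexWeight V a + vertexWeight V b := by
  obtain ⟨hab, ⟨w, hw, haw, hwb⟩ | hno⟩ := h
  · have haw' : (a : ℕ) < w := haw
    have hwb' : (w : ℕ) < b := hwb
    refine ⟨⟨a + 1, by omega⟩, ⟨b - 1, by omega⟩, by simp only; omega, ?_⟩
    obtain ⟨c, hc⟩ : ∃ c, (b : ℕ) = c + 1 := ⟨b - 1, by omega⟩
    have := slope_lt_slope_of_mem hw haw' (show (w : ℕ) ≤ c by omega)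
    simp only [hc, Nat.add_sub_cancel]
    rw [vertexWeight, vertexWeight, vertexWeight, vertexWeight, Finset.sum_range_succ,
      Finset.sum_range_succ]
    omega
  · have ha : (a : ℕ) ≠ 0 := by
      intro ha
      exact hno 0 h0 ⟨by rw [Fin.le_def, ha]; exact Nat.zero_le _, Fin.zero_le _⟩
    have hb : (b : ℕ) ≠ d := by
      intro hb
      exact hno _ hd ⟨Fin.le_last _, by rw [Fin.le_def, hb]; exact le_rfl⟩
    have hab' : (a : ℕ) ≤ b := hab
    refine ⟨⟨a - 1, by omega⟩, ⟨b + 1, by omega⟩, by simp only; omega, ?_⟩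
    obtain ⟨c, hc⟩ : ∃ c, (a : ℕ) = c + 1 := ⟨a - 1, by omega⟩
    have := slope_lt_slope_of_forall_notMem (V := V) (show c < (b : ℕ) by omega) (by omega)
      fun w hw hle => hno w hw ⟨by rw [Fin.le_def]; omega, hle.2⟩
    simp only [hc, Nat.add_sub_cancel]
    rw [vertexWeight, vertexWeight, vertexWeight, vertexWeight, Finset.sum_range_succ,
      Finset.sum_range_succ]
    omega

/-- If a monomial is not admissible, its bidegree is shared by a monomial of smaller weight. -/
lemma exists_weight_lt_of_not_admissible (h0 : 0 ∈ V) (hd : Fin.last d ∈ V)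
    {β : Fin (d + 1) →₀ ℕ} (hβ : ¬ Admissible V β) : ∃ γ, bideg d γ = bideg d β ∧
      Finsupp.weight (fun i : Fin (d + 1) => vertexWeight V i) γ <
        Finsupp.weight (fun i : Fin (d + 1) => vertexWeight V i) β := by
  simp only [Admissible, not_forall, not_not] at hβ
  obtain ⟨a, b, hab, hle⟩ := hβ
  obtain ⟨γ, rfl⟩ := exists_add_of_le hle
  obtain ⟨a', b', hsum, hlt⟩ := hab.exists_vertexWeight_lt h0 hd
  refine ⟨Finsupp.single a' 1 + Finsupp.single b' 1 + γ, ?_, ?_⟩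
  · simp only [map_add, bideg_single, one_mul, Prod.mk_add_mk, hsum]
  · simp only [map_add, Finsupp.weight_single, one_smul]
    omega

/-- An admissible monomial is the unique monomial of least weight among those of its bidegree. -/
lemma Admissible.eq_or_weight_lt (h0 : 0 ∈ V) (hd : Fin.last d ∈ V) {α β : Fin (d + 1) →₀ ℕ}
    (hα : Admissible V α) (hb : bideg d β = bideg d α) : β = α ∨
      Finsupp.weight (fun i : Fin (d + 1) => vertexWeight V i) α <
        Finsupp.weight (fun i : Fin (d + 1) => vertexWeight V i) β := by
  induction hn : Finsupp.weight (fun i : Fin (d + 1) => vertexWeight V i) β using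
    Nat.strong_induction_on generalizing β with
  | _ n ih =>
    by_cases hβ : Admissible V β
    · exact Or.inl (hβ.eq_of_bideg_eq hα hb)
    · obtain ⟨γ, hγ, hlt⟩ := exists_weight_lt_of_not_admissible h0 hd hβ
      rcases ih _ (hn ▸ hlt) (hγ.trans hb) rfl with rfl | h
      · exact Or.inr (hn ▸ hlt)
      · exact Or.inr (h.trans (hn ▸ hlt))

/-! ### The quadratic ideal as an initial ideal -/

variable (K : Type*) [Field K]

lemma quadricIdeal_eq_termInitialIdeal (hpos : 0 < d) (h0 : 0 ∈ V) (hd : Fin.last d ∈ V) :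
    quadricIdeal K V = RNC.termInitialIdeal
      (weightOrder fun i : Fin (d + 1) => vertexWeight V i) (curveIdeal K d) := by
  apply le_antisymm
  · refine (isMonomialIdeal_quadricIdeal K V).le_of_standard_subset fun α hα => ?_
    rw [mem_standard_quadricIdeal]
    by_contra hc
    obtain ⟨γ, hγ, hlt⟩ := exists_weight_lt_of_not_admissible h0 hd hc
    exact hα ((monomial_mem_termInitialIdeal_iff hpos _ α).2
      ⟨γ, hγ, weightOrder_lt_of_weight_lt _ hlt⟩)
  · refine (IsMonomialIdeal.termInitialIdeal _ _).le_of_standard_subset fun α hα hmem => ?_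
    obtain ⟨β, hβ, hlt⟩ := (monomial_mem_termInitialIdeal_iff hpos _ α).1 hmem
    rcases (mem_standard_quadricIdeal.1 hα).eq_or_weight_lt h0 hd hβ with rfl | h
    · exact lt_irrefl _ hlt
    · exact lt_asymm hlt (weightOrder_lt_of_weight_lt _ h)

lemma weight_cast {σ : Type*} (h : σ → ℕ) (α : σ →₀ ℕ) :
    Finsupp.weight (fun i => (h i : ℚ)) α = (Finsupp.weight h α : ℕ) := by
  simp [Finsupp.weight_apply, Finsupp.sum]

lemma initialForm_binomial {σ K : Type*} [Field K] (a : σ → ℚ) {α β : σ →₀ ℕ}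
    (hw : Finsupp.weight a β < Finsupp.weight a α) :
    initialForm a (monomial α 1 - monomial β 1 : MvPolynomial σ K) = monomial α 1 := by
  classical
  have hne : β ≠ α := by rintro rfl; exact lt_irrefl _ hw
  have hs := (support_initialForm _ _ _).1 (mem_support_initialForm_binomial (K := K) a hne hw.le)
  rw [initialForm, Finset.sum_eq_single_of_mem α (Finset.mem_filter.2 hs)]
  · simp [coeff_monomial, hne]
  · intro γ hγ hγα
    rw [Finset.mem_filter] at hγ
    have := support_sub _ _ _ hγ.1
    simp only [support_monomial, one_ne_zero, if_false, Finset.mem_union,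
      Finset.mem_singleton, hγα, false_or] at this
    subst this
    exact absurd (hγ.2 α hs.1) (not_le.2 hw)

lemma quadricIdeal_eq_weightInitialIdeal (hpos : 0 < d) (h0 : 0 ∈ V) (hd : Fin.last d ∈ V) :
    quadricIdeal K V = weightInitialIdeal (fun i : Fin (d + 1) => (vertexWeight V i : ℚ))
      (curveIdeal K d) := by
  apply le_antisymm
  · refine (isMonomialIdeal_quadricIdeal K V).le_of_standard_subset fun α hα => ?_
    rw [mem_standard_quadricIdeal]
    by_contra hc
    obtain ⟨γ, hγ, hlt⟩ := exists_weight_lt_of_not_admissible h0 hd hc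
    have hne : γ ≠ α := by rintro rfl; exact lt_irrefl _ hlt
    have hlt' : Finsupp.weight (fun i : Fin (d + 1) => (vertexWeight V i : ℚ)) γ <
        Finsupp.weight (fun i : Fin (d + 1) => (vertexWeight V i : ℚ)) α := by
      rw [weight_cast (fun i : Fin (d + 1) => vertexWeight V i),
        weight_cast (fun i : Fin (d + 1) => vertexWeight V i)]
      exact_mod_cast hlt
    refine hα (Ideal.subset_span ⟨_, monomial_sub_mem_curveIdeal K hγ.symm, ?_, ?_⟩)
    · intro h
      have := mem_support_initialForm_binomial (K := K) _ hne hlt'.le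
      rw [h, support_initialForm] at this
      simp at this
    · rw [initialForm_binomial _ hlt']
  · refine Ideal.span_le.2 ?_
    rintro _ ⟨f, hf, -, rfl⟩
    refine mem_of_forall_support fun α hα => ?_
    by_contra hc
    obtain ⟨β, hne, hb, hw⟩ := exists_of_mem_support_initialForm hpos _ hf hα
    rw [weight_cast (fun i : Fin (d + 1) => vertexWeight V i),
      weight_cast (fun i : Fin (d + 1) => vertexWeight V i)] at hw
    have hw' := Nat.cast_le.1 hw
    exact ((mem_standard_quadricIdeal.1 hc).eq_or_weight_lt h0 hd hb).elim hne (not_lt.2 hw')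

/-- A monomial ideal whose standard monomials form a section of the bidegree is a quadratic ideal
as soon as it contains its generators. -/
lemma eq_quadricIdeal_of_isSection {K : Type*} [Field K]
    {I : Ideal (MvPolynomial (Fin (d + 1)) K)} (hI : IsMonomialIdeal I)
    (hsec : IsSection (standard I)) (hV : ∀ α ∈ standard I, Admissible V α) :
    I = quadricIdeal K V := by
  apply le_antisymm
  · refine hI.le_of_standard_subset fun α hα => ?_
    obtain ⟨β, hβ, hb⟩ := hsec.2 α
    rwa [(mem_standard_quadricIdeal.1 hα).eq_of_bideg_eq (hV β hβ) hb.symm]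
  · exact (isMonomialIdeal_quadricIdeal K V).le_of_standard_subset
      fun α hα => mem_standard_quadricIdeal.2 (hV α hα)

end

end

section
open MvPolynomial Finsupp

/-! ### Unmixed sections of the bidegree -/

section
variable {d : ℕ} {B : Set (Fin (d + 1) →₀ ℕ)}

/-- The monomial `α` stays in `B` after multiplication with arbitrary powers of `t_u` and `t_v`. -/
def Free (B : Set (Fin (d + 1) →₀ ℕ)) (u v : Fin (d + 1)) (α : Fin (d + 1) →₀ ℕ) : Prop :=
  u < v ∧ ∀ a c, α + single u a + single v c ∈ B

/-- A section of the bidegree that is closed under divisors and is the union of translates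
of two-dimensional coordinate sectors. -/
structure IsUnmixedSection (B : Set (Fin (d + 1) →₀ ℕ)) : Prop where
  isSection : IsSection B
  mem_of_add : ∀ {α β}, α + β ∈ B → α ∈ B
  exists_free : ∀ α ∈ B, ∃ u v, Free B u v α

/-- The endpoints of the edges, i.e. of the pairs `u < v` such that `B` contains all monomials in
`t_u` and `t_v`. -/
def vertices (B : Set (Fin (d + 1) →₀ ℕ)) : Set (Fin (d + 1)) :=
  {w | ∃ v, Free B w v 0 ∨ Free B v w 0}

namespace IsUnmixedSection
variable (hB : IsUnmixedSection B)
include hB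

lemma eq_of_bideg {α β : Fin (d + 1) →₀ ℕ} (hα : α ∈ B) (hβ : β ∈ B)
    (h : bideg d α = bideg d β) : α = β := hB.isSection.1 α hα β hβ h

lemma free_of_add {u v : Fin (d + 1)} {α β : Fin (d + 1) →₀ ℕ} (h : Free B u v (α + β)) :
    Free B u v α :=
  ⟨h.1, fun a c => hB.mem_of_add (β := β) (by convert h.2 a c using 1; abel)⟩

lemma free_zero {u v : Fin (d + 1)} {α : Fin (d + 1) →₀ ℕ} (h : Free B u v α) : Free B u v 0 :=
  hB.free_of_add (β := α) (by rwa [zero_add])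

omit hB in
lemma pow_mem {w : Fin (d + 1)} (hw : w ∈ vertices B) (n : ℕ) : single w n ∈ B := by
  obtain ⟨v, h | h⟩ := hw
  · simpa using h.2 n 0
  · simpa using h.2 0 n

/-- No vertex lies strictly inside an edge: a suitable power of it would have the bidegree of a
monomial in the ends of the edge. -/
lemma notMem_vertices {u v w : Fin (d + 1)} (h : Free B u v 0) (huw : u < w) (hwv : w < v) :
    w ∉ vertices B := by
  intro hw
  have h1 := pow_mem hw (v - u)
  have h2 := h.2 (v - w) (w - u)
  rw [zero_add] at h2
  have huw' : (u : ℕ) < w := huw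
  have hwv' : (w : ℕ) < v := hwv
  have heq : single w ((v : ℕ) - u) = single u ((v : ℕ) - w) + single v ((w : ℕ) - u) := by
    refine hB.eq_of_bideg h1 h2 ?_
    rw [map_add, bideg_single, bideg_single, bideg_single, Prod.mk_add_mk, Prod.mk.injEq]
    refine ⟨by omega, ?_⟩
    zify [huw'.le, hwv'.le, (huw'.trans hwv').le]
    ring
  have := DFunLike.congr_fun heq w
  rw [single_eq_same, Finsupp.add_apply, single_eq_of_ne huw.ne', single_eq_of_ne hwv.ne] at this
  omega

/-- Two edges whose open intervals meet are equal. -/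
lemma edge_unique {u v u' v' : Fin (d + 1)} (h : Free B u v 0) (h' : Free B u' v' 0)
    (h1 : u < v') (h2 : u' < v) : u = u' ∧ v = v' := by
  have hu : u = u' := by
    rcases lt_trichotomy u u' with hlt | heq | hlt
    · exact absurd ⟨v', Or.inl h'⟩ (hB.notMem_vertices h hlt h2)
    · exact heq
    · exact absurd ⟨v, Or.inl h⟩ (hB.notMem_vertices h' hlt h1)
  subst hu
  rcases lt_trichotomy v v' with hlt | heq | hlt
  · exact absurd ⟨u, Or.inr h⟩ (hB.notMem_vertices h' h2 hlt)
  · exact ⟨rfl, heq⟩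
  · exact absurd ⟨u, Or.inr h'⟩ (hB.notMem_vertices h h1 hlt)

/-- If two monomials are free along the edge `u, v` and their bidegrees agree modulo the lattice
spanned by `(1, u)` and `(1, v)`, then they agree up to powers of `t_u` and `t_v`. -/
lemma apply_eq_of_free {u v : Fin (d + 1)} {α β : Fin (d + 1) →₀ ℕ} (hα : Free B u v α)
    (hβ : Free B u v β) {s : ℤ}
    (hs : ((bideg d α).2 - u * (bideg d α).1 : ℤ) - ((bideg d β).2 - u * (bideg d β).1) =
      s * (v - u)) {i : Fin (d + 1)} (hu : i ≠ u) (hv : i ≠ v) : α i = β i := by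
  set x : ℤ := (bideg d α).1 - (bideg d β).1 - s with hx
  have key : α + single u (-x).toNat + single v (-s).toNat =
      β + single u x.toNat + single v s.toNat := by
    refine hB.eq_of_bideg (hα.2 _ _) (hβ.2 _ _) ?_
    have e1 : (((-x).toNat : ℕ) : ℤ) = x.toNat - x := by omega
    have e2 : (((-s).toNat : ℕ) : ℤ) = s.toNat - s := by omega
    simp only [map_add, bideg_single]
    refine Prod.ext ?_ ?_
    · simp only [Prod.fst_add]
      omega
    · simp only [Prod.snd_add]
      zify
      rw [e1, e2]
      rw [hx]
      linear_combination hs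
  have := DFunLike.congr_fun key i
  simpa [single_eq_of_ne hu, single_eq_of_ne hv] using this

/-- All variables lie in an unmixed section, since `t_q` is the only monomial of its bidegree. -/
lemma single_mem (q : Fin (d + 1)) : single q 1 ∈ B := by
  obtain ⟨β, hβ, hb⟩ := hB.isSection.2 (single q 1)
  rw [bideg_single] at hb
  have hdeg : ∑ i, β i = 1 := by rw [← bideg_fst, hb]
  obtain ⟨i, -, hi⟩ : ∃ i ∈ Finset.univ, β i ≠ 0 := by
    by_contra! hc
    rw [Finset.sum_eq_zero hc] at hdeg
    exact zero_ne_one hdeg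
  obtain ⟨γ, rfl⟩ := exists_add_of_le (single_le_iff.2 (Nat.one_le_iff_ne_zero.2 hi))
  rw [map_add, bideg_single, Prod.ext_iff] at hb
  simp only [Prod.fst_add, Prod.snd_add, one_mul] at hb
  have hγ : γ = 0 := eq_zero_of_bideg_fst (by omega)
  subst hγ
  rw [map_zero, Prod.snd_zero, add_zero] at hb
  rw [add_zero] at hβ
  rwa [← Fin.ext hb.2]

end IsUnmixedSection

/-- A choice of an edge `(U q, W q)` for each variable `t_q`, such that `t_q` is free along it. -/
def IsEdgeChoice (B : Set (Fin (d + 1) →₀ ℕ)) (U W : Fin (d + 1) → Fin (d + 1)) : Prop :=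
  ∀ q, Free B (U q) (W q) (single q 1)

namespace IsUnmixedSection
variable (hB : IsUnmixedSection B)
include hB

lemma exists_isEdgeChoice : ∃ U W, IsEdgeChoice B U W := by
  choose U W h using fun q => hB.exists_free _ (hB.single_mem q)
  exact ⟨U, W, h⟩

variable {U W : Fin (d + 1) → Fin (d + 1)} (hUW : IsEdgeChoice B U W)
include hUW

lemma ne_of_notMem {q : Fin (d + 1)} (hq : q ∉ vertices B) : q ≠ U q ∧ q ≠ W q :=
  ⟨fun h => hq ⟨W q, Or.inl (by have := hB.free_zero (hUW q); rwa [← h] at this)⟩,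
    fun h => hq ⟨U q, Or.inr (by have := hB.free_zero (hUW q); rwa [← h] at this)⟩⟩

omit hUW in
/-- An integer in the residue class of `m` strictly between the ends of an edge, if `m` is not
congruent to these ends. -/
lemma exists_notMem_vertices {u v : Fin (d + 1)} (h : Free B u v 0) {m : ℤ}
    (hm : ¬ ∃ s : ℤ, m - u = s * (v - u)) :
    ∃ r, r ∉ vertices B ∧ u < r ∧ r < v ∧ ∃ s : ℤ, m - r = s * (v - u) := by
  have huv : (u : ℕ) < v := h.1
  have he : (0 : ℤ) < v - u := by omega
  have h1 := Int.emod_nonneg (m - u) he.ne'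
  have h2 := Int.emod_lt_of_pos (m - u) he
  have h3 := Int.emod_add_mul_ediv (m - u) (v - u)
  have h4 : (m - u) % (v - u) ≠ 0 := by
    intro h0
    rw [h0, zero_add] at h3
    exact hm ⟨_, h3.symm.trans (mul_comm _ _)⟩
  obtain ⟨k, hk⟩ := Int.eq_ofNat_of_zero_le h1
  rw [hk] at h2 h3 h4
  have hv := v.2
  let r : Fin (d + 1) := ⟨u + k, by omega⟩
  have hur : u < r := by rw [Fin.lt_def]; simp only [r]; omega
  have hrv : r < v := by rw [Fin.lt_def]; simp only [r]; omega
  refine ⟨r, hB.notMem_vertices h hur hrv, hur, hrv, (m - u) / (v - u), ?_⟩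
  simp only [r]
  push_cast
  linear_combination -h3

/-- Reducing each `q` modulo the length of its edge to the inside of the edge is injective, hence
bijective, on the complement of the vertices. -/
lemma exists_perm : ∃ ψ : Equiv.Perm ((vertices B)ᶜ : Set (Fin (d + 1))),
    ∀ q : ((vertices B)ᶜ : Set (Fin (d + 1))), U q < (ψ q : Fin (d + 1)) ∧
      (ψ q : Fin (d + 1)) < W q ∧
      ∃ s : ℤ, ((q : Fin (d + 1)) : ℤ) - (ψ q : Fin (d + 1)) = s * (W q - U q) := by
  have hex : ∀ q : ((vertices B)ᶜ : Set (Fin (d + 1))),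
      ∃ r : ((vertices B)ᶜ : Set (Fin (d + 1))), U q < (r : Fin (d + 1)) ∧
        (r : Fin (d + 1)) < W q ∧
        ∃ s : ℤ, ((q : Fin (d + 1)) : ℤ) - (r : Fin (d + 1)) = s * (W q - U q) := by
    intro q
    obtain ⟨hu, hv⟩ := hB.ne_of_notMem hUW q.2
    have h0 := hB.free_zero (hUW q)
    obtain ⟨r, hr, h⟩ := hB.exists_notMem_vertices h0 (m := (q : Fin (d + 1))) (by
      rintro ⟨s, hs⟩
      have := hB.apply_eq_of_free (hUW q) h0 (s := s) (by simp [hs]) hu hv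
      simp at this)
    exact ⟨⟨r, hr⟩, h⟩
  choose ψ h1 h2 h3 using hex
  have hinj : Function.Injective ψ := by
    intro q q' hqq
    obtain ⟨hu, hv⟩ := hB.edge_unique (hB.free_zero (hUW q)) (hB.free_zero (hUW q'))
      ((h1 q).trans (hqq ▸ h2 q')) ((h1 q').trans (hqq ▸ h2 q))
    obtain ⟨s, hs⟩ := h3 q
    obtain ⟨s', hs'⟩ := h3 q'
    have hq' := hUW q'
    rw [← hu, ← hv, ← hqq] at hs'
    rw [← hu, ← hv] at hq'
    have := hB.apply_eq_of_free (hUW q) hq' (s := s - s')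
      (by simp only [bideg_single]; push_cast; linear_combination hs - hs')
      (hB.ne_of_notMem hUW q.2).1 (hB.ne_of_notMem hUW q.2).2
    rw [single_eq_same, single_apply] at this
    by_contra hne
    rw [if_neg fun h => hne (Subtype.ext h.symm)] at this
    exact one_ne_zero this
  exact ⟨Equiv.ofBijective ψ (Finite.injective_iff_bijective.1 hinj), fun q => ⟨h1 q, h2 q, h3 q⟩⟩

/-- Each residue class modulo the length of an edge, other than that of its ends, contains some `q`
for which the edge was chosen. -/
lemma exists_residue {u v : Fin (d + 1)} (h : Free B u v 0) {m : ℤ}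
    (hm : ¬ ∃ s : ℤ, m - u = s * (v - u)) :
    ∃ q, q ∉ vertices B ∧ U q = u ∧ W q = v ∧ ∃ s : ℤ, m - q = s * (v - u) := by
  obtain ⟨ψ, hψ⟩ := hB.exists_perm hUW
  obtain ⟨r, hr, hur, hrv, s, hs⟩ := hB.exists_notMem_vertices h hm
  obtain ⟨q, hq⟩ := ψ.surjective ⟨r, hr⟩
  obtain ⟨h1, h2, s', h3⟩ := hψ q
  rw [hq] at h1 h2 h3
  obtain ⟨hu, hv⟩ := hB.edge_unique h (hB.free_zero (hUW q)) (hur.trans h2) (h1.trans hrv)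
  refine ⟨q, q.2, hu.symm, hv.symm, s - s', ?_⟩
  rw [← hu, ← hv] at h3
  linear_combination hs - h3

/-- Along an edge, the only free monomials in the other variables are `1` and the `t_q` for which
the edge was chosen: these already represent all residue classes. -/
lemma eq_zero_or_eq_single {u v : Fin (d + 1)} {α : Fin (d + 1) →₀ ℕ} (h : Free B u v α)
    (hu : α u = 0) (hv : α v = 0) :
    α = 0 ∨ ∃ q, q ∉ vertices B ∧ U q = u ∧ W q = v ∧ α = single q 1 := by
  have h0 := hB.free_zero h
  by_cases hm : ∃ s : ℤ, ((bideg d α).2 - u * (bideg d α).1 + u : ℤ) - u = s * (v - u)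
  · left
    obtain ⟨s, hs⟩ := hm
    ext i
    by_cases hiu : i = u
    · rw [hiu, hu]; rfl
    by_cases hiv : i = v
    · rw [hiv, hv]; rfl
    exact hB.apply_eq_of_free h h0 (s := s) (by simp only [map_zero]; simp; linarith) hiu hiv
  · right
    obtain ⟨q, hq, rfl, rfl, s, hs⟩ := hB.exists_residue hUW h0 hm
    refine ⟨q, hq, rfl, rfl, ?_⟩
    obtain ⟨hqu, hqv⟩ := hB.ne_of_notMem hUW hq
    ext i
    by_cases hiu : i = U q
    · rw [hiu, hu, single_eq_of_ne hqu.symm]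
    by_cases hiv : i = W q
    · rw [hiv, hv, single_eq_of_ne hqv.symm]
    exact hB.apply_eq_of_free h (hUW q) (s := s)
      (by simp only [bideg_single]; push_cast; linear_combination hs) hiu hiv

/-- The normal form of the elements of an unmixed section. -/
lemma exists_eq {α : Fin (d + 1) →₀ ℕ} (hα : α ∈ B) : ∃ u v a c, Free B u v 0 ∧
    (α = single u a + single v c ∨
      ∃ q, q ∉ vertices B ∧ U q = u ∧ W q = v ∧ α = single q 1 + (single u a + single v c)) := by
  obtain ⟨u, v, h⟩ := hB.exists_free α hα
  have hsplit : α = (α.erase u).erase v + (single u (α u) + single v (α v)) := by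
    classical
    ext i
    simp only [Finsupp.add_apply, erase_apply, single_apply]
    have := h.1.ne
    split_ifs <;> subst_vars <;> omega
  have hfree : Free B u v ((α.erase u).erase v) := by
    rw [hsplit] at h
    exact hB.free_of_add h
  refine ⟨u, v, α u, α v, hB.free_zero h, ?_⟩
  rcases hB.eq_zero_or_eq_single hUW hfree (by rw [erase_ne h.1.ne, erase_same])
    (by rw [erase_same]) with h0 | ⟨q, hq, hu, hv, h1⟩
  · left
    rw [h0, zero_add] at hsplit
    exact hsplit
  · right
    rw [h1] at hsplit
    exact ⟨q, hq, hu, hv, hsplit⟩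

end IsUnmixedSection
end

section
variable {d : ℕ} {B : Set (Fin (d + 1) →₀ ℕ)}
namespace IsUnmixedSection
variable (hB : IsUnmixedSection B) {U W : Fin (d + 1) → Fin (d + 1)} (hUW : IsEdgeChoice B U W)
include hB hUW

/-- The normal form of the monomial of a given bidegree, numerically. -/
lemma exists_edge_of_le {n m : ℕ} (hm : m ≤ d * n) : ∃ u v, Free B u v 0 ∧
    ∃ e a c q : ℕ, e ≤ 1 ∧ q ≤ d ∧ e + a + c = n ∧ e * q + a * u + c * v = m := by
  obtain ⟨α₀, hα₀⟩ := exists_bideg_eq n m hm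
  obtain ⟨α, hα, hb⟩ := hB.isSection.2 α₀
  rw [hα₀] at hb
  obtain ⟨u, v, a, c, h, hα'⟩ := hB.exists_eq hUW hα
  refine ⟨u, v, h, ?_⟩
  rcases hα' with rfl | ⟨q, -, -, -, rfl⟩
  · refine ⟨0, a, c, 0, by omega, by omega, ?_⟩
    simpa [Prod.ext_iff] using hb
  · refine ⟨1, a, c, q, le_rfl, Fin.le_last q, ?_⟩
    simpa [Prod.ext_iff, ← add_assoc] using hb

lemma zero_mem_vertices : 0 ∈ vertices B := by
  obtain ⟨u, v, h, e, a, c, q, he, hq, h1, h2⟩ :=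
    hB.exists_edge_of_le hUW (n := 2) (m := 0) (Nat.zero_le _)
  have huv : (u : ℕ) < v := h.1
  simp only [Nat.add_eq_zero_iff, Nat.mul_eq_zero] at h2
  have hu : u = 0 := by
    apply Fin.ext
    rw [Fin.val_zero]
    omega
  exact ⟨v, Or.inl (hu ▸ h)⟩

lemma last_mem_vertices : Fin.last d ∈ vertices B := by
  obtain ⟨u, v, h, e, a, c, q, he, hq, h1, h2⟩ :=
    hB.exists_edge_of_le hUW (n := 2) (m := d * 2) le_rfl
  have huv : (u : ℕ) < v := h.1
  have hvd : (v : ℕ) ≤ d := Fin.le_last v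
  have hv : v = Fin.last d := by
    apply Fin.ext
    rw [Fin.val_last]
    have ha : a ≤ 2 := by omega
    have hc : c ≤ 2 := by omega
    interval_cases e <;> interval_cases a <;> interval_cases c <;> omega
  exact ⟨u, Or.inr (hv ▸ h)⟩

/-- Every vertex other than `d` is the left end of an edge. -/
lemma exists_next {v : Fin (d + 1)} (hv : v ∈ vertices B) (hvd : v < Fin.last d) :
    ∃ w, Free B v w 0 := by
  have hvd' : (v : ℕ) < d := hvd
  -- a bidegree `(n, n v + d + 1)` of slope only slightly larger than `v`
  obtain ⟨u, w, h, e, a, c, q, he, hq, h1, h2⟩ := hB.exists_edge_of_le hUW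
    (n := 2 * d + 3) (m := (2 * d + 3) * v + (d + 1)) (by nlinarith)
  have huw : (u : ℕ) < w := h.1
  have heq : e * q ≤ d := by interval_cases e <;> omega
  have hvw : v < w := by
    by_contra hc
    have hwv : (w : ℕ) ≤ v := not_lt.1 hc
    have h3 : a * u ≤ a * v := Nat.mul_le_mul_left _ (by omega)
    have h4 : c * w ≤ c * v := Nat.mul_le_mul_left _ hwv
    have h5 : (a + c) * v ≤ (2 * d + 3) * v := Nat.mul_le_mul_right _ (by omega)
    rw [add_mul] at h5
    omega
  rcases lt_trichotomy u v with huv | rfl | huv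
  · exact absurd hv (hB.notMem_vertices h huv hvw)
  · exact ⟨w, h⟩
  · exfalso
    have huv' : (v : ℕ) + 1 ≤ u := huv
    have h3 : a * (v + 1) ≤ a * u := Nat.mul_le_mul_left _ huv'
    have h4 : c * (v + 1) ≤ c * w := Nat.mul_le_mul_left _ (by omega)
    have h5 : (2 * d + 2) * ((v : ℕ) + 1) ≤ (a + c) * (v + 1) := Nat.mul_le_mul_right _ (by omega)
    nlinarith

/-- The variable `t_q` does not lie to the right of its edge. Otherwise, in the residue class of
`q` with respect to the next edge, there would be a variable to the right of that edge. -/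
lemma lt_right {q : Fin (d + 1)} (hq : q ∉ vertices B) : q < W q := by
  induction hn : d - (W q : ℕ) using Nat.strong_induction_on generalizing q with
  | _ n ih =>
    by_contra hc
    have hne := hB.ne_of_notMem hUW hq
    have hlt : W q < q := lt_of_le_of_ne (not_lt.1 hc) hne.2.symm
    have hWV : W q ∈ vertices B := ⟨U q, Or.inr (hB.free_zero (hUW q))⟩
    obtain ⟨w, hw⟩ := hB.exists_next hUW hWV (hlt.trans_le (Fin.le_last q))
    have hwV : w ∈ vertices B := ⟨W q, Or.inr hw⟩
    have hqw : q ≠ w := fun h => hq (h ▸ hwV)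
    have hvw : (W q : ℕ) < w := hw.1
    have hlt' : (W q : ℕ) < q := hlt
    by_cases hm : ∃ s : ℤ, (q : ℤ) - (W q : Fin (d + 1)) = s * (w - (W q : Fin (d + 1)))
    · obtain ⟨s, hs⟩ := hm
      have hs0 : 0 < s := by
        by_contra hs0
        nlinarith
      obtain ⟨k, rfl⟩ : ∃ k : ℕ, s = k + 1 := ⟨(s - 1).toNat, by omega⟩
      have h1 := (hUW q).2 0 k
      have h2 := pow_mem hwV (k + 1)
      have := hB.eq_of_bideg h1 h2 (by
        simp only [map_add, bideg_single, Prod.ext_iff, Prod.fst_add, Prod.snd_add]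
        refine ⟨by omega, ?_⟩
        zify
        linear_combination hs)
      have := DFunLike.congr_fun this q
      simp [single_eq_of_ne hqw] at this
    · obtain ⟨r, hr, hUr, hWr, s, hs⟩ := hB.exists_residue hUW hw hm
      have hqr : q ≠ r := by
        rintro rfl
        exact hw.1.ne hWr
      by_cases hs0 : 0 ≤ s
      · obtain ⟨k, rfl⟩ := Int.eq_ofNat_of_zero_le hs0
        have h1 := (hUW q).2 0 k
        have h2 := (hUW r).2 0 k
        rw [hWr] at h2
        have := hB.eq_of_bideg h1 h2 (by
          simp only [map_add, bideg_single, Prod.ext_iff, Prod.fst_add, Prod.snd_add]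
          refine ⟨trivial, ?_⟩
          zify
          linear_combination hs)
        have := DFunLike.congr_fun this q
        simp [single_eq_of_ne hqw, single_eq_of_ne hne.2, single_eq_of_ne hqr] at this
      · have h1 : (r : ℕ) < w := by
          have := ih (d - (w : ℕ)) (by omega) hr (by rw [hWr])
          rwa [hWr] at this
        push Not at hs0
        nlinarith

/-- The edge chosen for `t_q` encloses `q`: as no variable lies to the right of its edge, the
reduction modulo the length of the edge decreases no `q`, and a permutation with this property is
the identity. -/
lemma mem_edge {q : Fin (d + 1)} (hq : q ∉ vertices B) : U q < q ∧ q < W q := by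
  obtain ⟨ψ, hψ⟩ := hB.exists_perm hUW
  have hle : ∀ q : ((vertices B)ᶜ : Set (Fin (d + 1))),
      ((q : Fin (d + 1)) : ℕ) ≤ (ψ q : Fin (d + 1)) := by
    intro q
    obtain ⟨h1, h2, s, hs⟩ := hψ q
    have h3 : ((q : Fin (d + 1)) : ℕ) < W q := hB.lt_right hUW q.2
    have h1' : (U q : ℕ) < (ψ q : Fin (d + 1)) := h1
    have h2' : ((ψ q : Fin (d + 1)) : ℕ) < W q := h2
    by_contra hc
    have hs0 : 0 < s := by
      by_contra hs0
      nlinarith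
    nlinarith
  classical
  have hsum := (Finset.sum_eq_sum_iff_of_le fun q (_ : q ∈ Finset.univ) => hle q).1
    (Equiv.sum_comp ψ fun q => ((q : Fin (d + 1)) : ℕ)).symm ⟨q, hq⟩ (Finset.mem_univ _)
  obtain ⟨h1, h2, -⟩ := hψ ⟨q, hq⟩
  rw [← Fin.ext hsum] at h1 h2
  exact ⟨h1, h2⟩

omit hUW in
/-- The elements of an unmixed section are the admissible monomials with respect to its
vertices. -/
theorem admissible {α : Fin (d + 1) →₀ ℕ} (hα : α ∈ B) : Admissible (vertices B) α := by
  classical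
  obtain ⟨U, W, hUW⟩ := hB.exists_isEdgeChoice
  rintro a b ⟨hab, hforb⟩ hle
  obtain ⟨γ, rfl⟩ := exists_add_of_le hle
  obtain ⟨u, v, x, y, h, hcase⟩ := hB.exists_eq hUW (hB.mem_of_add hα)
  have hu : u ∈ vertices B := ⟨v, Or.inl h⟩
  have hv : v ∈ vertices B := ⟨u, Or.inr h⟩
  have huv := h.1
  have hends : (u ≤ a ∧ a ≤ v) ∧ (u ≤ b ∧ b ≤ v) ∧ (a ∈ vertices B ∨ b ∈ vertices B) := by
    rcases hcase with heq | ⟨q, hq, hUq, hWq, heq⟩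
    · have hmem : ∀ i, (single a 1 + single b 1 : Fin (d + 1) →₀ ℕ) i ≠ 0 → i = u ∨ i = v := by
        intro i hi
        rw [heq] at hi
        by_contra! hc
        exact hi (by simp [single_eq_of_ne hc.1, single_eq_of_ne hc.2])
      have ha := hmem a (by simp)
      have hb := hmem b (by simp)
      rcases ha with rfl | rfl <;> rcases hb with rfl | rfl <;> simp [huv.le, hu, hv]
    · obtain ⟨h1, h2⟩ := hB.mem_edge hUW hq
      rw [hUq] at h1
      rw [hWq] at h2
      have hmem : ∀ i, (single a 1 + single b 1 : Fin (d + 1) →₀ ℕ) i ≠ 0 →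
          i = q ∨ i = u ∨ i = v := by
        intro i hi
        rw [heq] at hi
        by_contra! hc
        exact hi (by simp [single_eq_of_ne hc.1, single_eq_of_ne hc.2.1, single_eq_of_ne hc.2.2])
      have ha := hmem a (by simp)
      have hb := hmem b (by simp)
      have hnot : ¬ (a = q ∧ b = q) := by
        rintro ⟨ha', hb'⟩
        rw [ha', hb'] at heq
        have := DFunLike.congr_fun heq q
        simp [single_eq_of_ne h1.ne', single_eq_of_ne h2.ne] at this
      rcases ha with rfl | rfl | rfl <;> rcases hb with rfl | rfl | rfl <;>
        simp_all [huv.le, h1.le, h2.le]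
  obtain ⟨⟨h1, h2⟩, ⟨h3, h4⟩, h5⟩ := hends
  rcases hforb with ⟨w, hw, haw, hwb⟩ | hno
  · exact hB.notMem_vertices h (h1.trans_lt haw) (hwb.trans_le h4) hw
  · rcases h5 with h5 | h5
    · exact hno a h5 ⟨le_rfl, hab⟩
    · exact hno b h5 ⟨hab, le_rfl⟩

end IsUnmixedSection
end

/-! ### Depth two excludes one-dimensional associated primes -/

/-- In a Noetherian local ring with a regular sequence of length two there is no associated prime
modulo which the maximal ideal is principal. -/
lemma false_of_regular_pair {R : Type*} [CommRing R] [IsLocalRing R] [IsNoetherianRing R] {f g : R}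
    (hfm : f ∈ IsLocalRing.maximalIdeal R) (hgm : g ∈ IsLocalRing.maximalIdeal R)
    (hf : IsSMulRegular R f) (hg : IsSMulRegular (QuotSMulTop f R) g)
    {p : Ideal R} [hp : p.IsPrime] {y : R} (hpy : ∀ r, r ∈ p ↔ r * y = 0) {t : R}
    (htm : t ∈ IsLocalRing.maximalIdeal R)
    (ht : IsLocalRing.maximalIdeal R ≤ p ⊔ Ideal.span {t}) : False := by
  have hy : y ≠ 0 := fun hy => hp.ne_top ((Ideal.eq_top_iff_one _).2 ((hpy 1).2 (by simp [hy])))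
  have hf' : ∀ x, f * x = 0 → x = 0 := fun x hx => hf (by simpa using hx)
  have hg' : ∀ x, f ∣ g * x → f ∣ x := by
    rintro x ⟨z, hz⟩
    have h0 : (Submodule.Quotient.mk x : QuotSMulTop f R) = 0 := by
      apply hg
      change g • (Submodule.Quotient.mk x : QuotSMulTop f R) =
        g • (0 : QuotSMulTop f R)
      rw [smul_zero, ← Submodule.Quotient.mk_smul, Submodule.Quotient.mk_eq_zero]
      exact (Submodule.mem_smul_pointwise_iff_exists _ _ _).2 ⟨z, trivial, hz.symm⟩
    rw [Submodule.Quotient.mk_eq_zero] at h0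
    obtain ⟨z, -, hz⟩ := (Submodule.mem_smul_pointwise_iff_exists _ _ _).1 h0
    exact ⟨z, hz.symm⟩
  have hgpow : ∀ k x, f ∣ g ^ k * x → f ∣ x := by
    intro k
    induction k with
    | zero => intro x hx; simpa using hx
    | succ k ih => intro x hx; exact ih x (hg' _ (by rwa [pow_succ', mul_assoc] at hx))
  have hfp : f ∉ p := fun h => hy (hf' y ((hpy f).1 h))
  have hpm : p ≤ IsLocalRing.maximalIdeal R := IsLocalRing.le_maximalIdeal hp.ne_top
  let π := Ideal.Quotient.mk p
  have hexp : ∀ x ∈ IsLocalRing.maximalIdeal R, ∃ b, π x = π b * π t := by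
    intro x hx
    obtain ⟨a, ha, c, hc, rfl⟩ := Submodule.mem_sup.1 (ht hx)
    obtain ⟨b, rfl⟩ := Ideal.mem_span_singleton'.1 hc
    refine ⟨b, ?_⟩
    rw [map_add, map_mul, show π a = 0 from Ideal.Quotient.eq_zero_iff_mem.2 ha, zero_add]
  -- modulo `p`, the element `f` is a unit times a power of `t`
  have htop : Ideal.span {π t} ≠ ⊤ := by
    intro h
    obtain ⟨c, hc⟩ := Ideal.mem_span_singleton'.1 ((Ideal.eq_top_iff_one _).1 h)
    obtain ⟨c, rfl⟩ := Ideal.Quotient.mk_surjective c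
    have h1 : c * t - 1 ∈ p := Ideal.Quotient.eq.1 (by rw [map_mul, map_one]; exact hc)
    have h2 := Ideal.sub_mem _ (Ideal.mul_mem_left _ c htm) (hpm h1)
    rw [sub_sub_cancel] at h2
    exact (Ideal.ne_top_iff_one _).1 (IsLocalRing.maximalIdeal.isMaximal R).ne_top h2
  have hkrull : ∃ k, ¬ π t ^ k ∣ π f := by
    by_contra! hc
    have : π f ∈ ⨅ k, Ideal.span {π t} ^ k := by
      rw [Ideal.mem_iInf]
      intro k
      rw [Ideal.span_singleton_pow, Ideal.mem_span_singleton]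
      exact hc k
    rw [Ideal.iInf_pow_eq_bot_of_isDomain _ htop, Ideal.mem_bot,
      Ideal.Quotient.eq_zero_iff_mem] at this
    exact hfp this
  classical
  obtain ⟨k, hk⟩ : ∃ k, π t ^ k ∣ π f ∧ ¬ π t ^ (k + 1) ∣ π f := by
    have h := Nat.find_spec hkrull
    have hpos : Nat.find hkrull ≠ 0 := by
      intro h0
      rw [h0, pow_zero] at h
      exact h (one_dvd _)
    refine ⟨Nat.find hkrull - 1, not_not.1 (Nat.find_min hkrull (by omega)), ?_⟩
    rwa [Nat.sub_add_cancel (Nat.one_le_iff_ne_zero.2 hpos)]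
  obtain ⟨⟨c, hc⟩, hk'⟩ := hk
  obtain ⟨c, rfl⟩ := Ideal.Quotient.mk_surjective c
  have hunit : IsUnit c := by
    by_contra hcu
    obtain ⟨b, hb⟩ := hexp c ((IsLocalRing.mem_maximalIdeal _).2 hcu)
    apply hk'
    rw [hc, pow_succ]
    exact mul_dvd_mul_left _ ⟨π b, hb.trans (mul_comm _ _)⟩
  have hgf : ∃ e, g ^ k - e * f ∈ p := by
    obtain ⟨b, hb⟩ := hexp g hgm
    obtain ⟨c', hc'⟩ := hunit.exists_right_inv
    refine ⟨b ^ k * c', Ideal.Quotient.eq.1 ?_⟩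
    have h1 : π c * π c' = 1 := by rw [← map_mul, hc', map_one]
    change π (g ^ k) = π (b ^ k * c' * f)
    rw [map_mul, map_mul, map_pow, map_pow, hb, hc, mul_pow]
    change _ = π b ^ k * π c' * (π t ^ k * π c)
    linear_combination (- π b ^ k * π t ^ k) * h1
  obtain ⟨e, he⟩ := hgf
  -- the elements annihilated by `p` are divisible by `f`, within the set of these elements
  let N : Ideal R := (⊥ : Ideal R).colon (p : Set R)
  have hN : ∀ z, z ∈ N ↔ ∀ r ∈ p, r * z = 0 := by
    intro z
    simp only [N, Submodule.mem_colon, SetLike.mem_coe, Ideal.mem_bot, smul_eq_mul]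
    exact forall₂_congr fun r _ => by rw [mul_comm]
  have hle : N ≤ Ideal.span {f} • N := by
    intro z hz
    have hz' := (hN z).1 hz
    obtain ⟨z', rfl⟩ := hgpow k z ⟨e * z, by linear_combination hz' _ he⟩
    refine Ideal.mul_mem_mul (Ideal.mem_span_singleton_self f) ((hN z').2 fun r hr => hf' _ ?_)
    linear_combination hz' r hr
  have hbot := Submodule.eq_bot_of_le_smul_of_le_jacobson_bot (Ideal.span {f}) N
    (IsNoetherian.noetherian N) hle (by
      rw [IsLocalRing.jacobson_eq_maximalIdeal _ bot_ne_top, Ideal.span_singleton_le_iff_mem]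
      exact hfm)
  have : y ∈ N := (hN y).2 fun r hr => (hpy r).1 hr
  rw [hbot] at this
  exact hy this

/-! ### Sections contain an edge -/

section
variable {d : ℕ} {B : Set (Fin (d + 1) →₀ ℕ)}

/-- A section that is closed under divisors contains all monomials in some two variables. Otherwise
each of its elements is a power of one variable up to a factor of bounded degree, and such monomials
do not represent all bidegrees. -/
lemma IsSection.exists_free_zero (hd : 0 < d) (hB : IsSection B)
    (hlow : ∀ {α β}, α + β ∈ B → α ∈ B) : ∃ u v, Free B u v 0 := by
  by_contra! hcon
  have hex : ∀ u v : Fin (d + 1), ∃ N, u < v → ∀ n, N ≤ n → single u n + single v n ∉ B := by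
    intro u v
    by_cases huv : u < v
    · have := hcon u v
      simp only [Free, huv, true_and, zero_add, not_forall] at this
      obtain ⟨a, c, hac⟩ := this
      refine ⟨a + c, fun _ n hn hmem => hac (hlow (β := single u (n - a) + single v (n - c)) ?_)⟩
      rw [add_add_add_comm, ← single_add, ← single_add, Nat.add_sub_cancel' (by omega),
        Nat.add_sub_cancel' (by omega)]
      exact hmem
    · exact ⟨0, fun h => absurd h huv⟩
  choose N hN using hex
  obtain ⟨M, hM⟩ : ∃ M, ∀ u v, N u v ≤ M :=
    ⟨∑ u, ∑ v, N u v, fun u v => (Finset.single_le_sum (f := fun v => N u v)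
      (fun _ _ => Nat.zero_le _) (Finset.mem_univ v)).trans
      (Finset.single_le_sum (f := fun u => ∑ v, N u v) (fun _ _ => Nat.zero_le _)
        (Finset.mem_univ u))⟩
  -- a sum of indices beyond `d` times the degree of the bounded factor, but much smaller than
  -- the degree: such a monomial is close neither to a power of `t_0` nor to one of another `t_w`
  obtain ⟨α₀, hα₀⟩ := exists_bideg_eq (d := d) (d * (d * M) + 1 + (d * M) + M + 1) (d * (d * M) + 1)
    (le_trans (by omega) (Nat.le_mul_of_pos_left _ hd))
  obtain ⟨α, hα, hb⟩ := hB.2 α₀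
  rw [hα₀] at hb
  have hsmall : ∀ u v, u < v → α u < M ∨ α v < M := by
    intro u v huv
    by_contra! hc
    refine hN u v huv M (hM u v) ?_
    obtain ⟨γ, hγ⟩ := exists_add_of_le (show single u M + single v M ≤ α by
      intro i
      rw [Finsupp.add_apply]
      by_cases hiu : i = u
      · subst hiu
        rw [single_eq_same, single_eq_of_ne huv.ne]
        exact hc.1
      · by_cases hiv : i = v
        · subst hiv
          rw [single_eq_same, single_eq_of_ne hiu, zero_add]
          exact hc.2
        · rw [single_eq_of_ne hiu, single_eq_of_ne hiv]
          exact Nat.zero_le _)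
    exact hlow (hγ ▸ hα)
  have hdeg := bideg_fst α
  have hwt := bideg_snd α
  rw [hb] at hdeg hwt
  simp only at hdeg hwt
  obtain ⟨w, hw⟩ : ∃ w, ∀ i, i ≠ w → α i ≤ M := by
    by_cases h : ∃ w, M ≤ α w
    · obtain ⟨w, hw⟩ := h
      refine ⟨w, fun i hi => ?_⟩
      rcases lt_or_gt_of_ne hi with hlt | hlt
      · have := hsmall i w hlt; omega
      · have := hsmall w i hlt; omega
    · push Not at h
      exact ⟨0, fun i _ => (h i).le⟩
  have hrest : ∑ i ∈ Finset.univ.erase w, α i ≤ d * M := by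
    refine (Finset.sum_le_card_nsmul _ _ M fun i hi => hw i (Finset.ne_of_mem_erase hi)).trans ?_
    rw [Finset.card_erase_of_mem (Finset.mem_univ _), Finset.card_univ, Fintype.card_fin,
      Nat.add_sub_cancel, smul_eq_mul]
  rw [← Finset.add_sum_erase _ _ (Finset.mem_univ w)] at hdeg hwt
  by_cases hw0 : w = 0
  · subst hw0
    have : ∑ i ∈ Finset.univ.erase (0 : Fin (d + 1)), α i * (i : ℕ) ≤ d * (d * M) := by
      calc _ ≤ ∑ i ∈ Finset.univ.erase (0 : Fin (d + 1)), α i * d :=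
            Finset.sum_le_sum fun i _ => Nat.mul_le_mul_left _ (Fin.le_last i)
        _ = (∑ i ∈ Finset.univ.erase (0 : Fin (d + 1)), α i) * d := (Finset.sum_mul _ _ _).symm
        _ ≤ _ := by rw [mul_comm]; exact Nat.mul_le_mul_left _ hrest
    simp only [Fin.val_zero, mul_zero, zero_add] at hwt
    omega
  · have h1 : α w * 1 ≤ α w * w := Nat.mul_le_mul_left _
      (Nat.one_le_iff_ne_zero.2 fun h => hw0 (Fin.ext h))
    omega

end

/-! ### Unmixedness of Cohen-Macaulay quotients by monomial ideals -/

section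
variable {σ K : Type*} [Field K]

open Classical in
/-- The substitution that sets the variables outside `T` to zero. -/
def restrictVars (K : Type*) [Field K] (T : Set σ) : MvPolynomial σ K →ₐ[K] MvPolynomial σ K :=
  aeval fun i => if i ∈ T then X i else 0

lemma restrictVars_X_of_mem {T : Set σ} {i : σ} (hi : i ∈ T) : restrictVars K T (X i) = X i := by
  rw [restrictVars, aeval_X, if_pos hi]

lemma restrictVars_X_of_notMem {T : Set σ} {i : σ} (hi : i ∉ T) : restrictVars K T (X i) = 0 := by
  rw [restrictVars, aeval_X, if_neg hi]

lemma restrictVars_restrictVars {T T' : Set σ} (h : T' ⊆ T) (f : MvPolynomial σ K) :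
    restrictVars K T' (restrictVars K T f) = restrictVars K T' f := by
  rw [← AlgHom.comp_apply]
  congr 1
  ext i : 1
  rw [AlgHom.comp_apply]
  by_cases hi : i ∈ T
  · rw [restrictVars_X_of_mem hi]
  · rw [restrictVars_X_of_notMem hi, map_zero, restrictVars_X_of_notMem fun h' => hi (h h')]

/-- An ideal is contained in the prime ideal of a coordinate subspace if it contains no monomial in
the coordinates of the subspace. -/
lemma restrictVars_eq_zero {I : Ideal (MvPolynomial σ K)} (hI : IsMonomialIdeal I) {T : Set σ}
    (hT : ∀ α : σ →₀ ℕ, (α.support : Set σ) ⊆ T → α ∈ standard I) {f : MvPolynomial σ K}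
    (hf : f ∈ I) : restrictVars K T f = 0 := by
  rw [f.as_sum, map_sum]
  refine Finset.sum_eq_zero fun α hα => ?_
  have hnot : ¬ (α.support : Set σ) ⊆ T := fun h => hT α h (hI.mem_iff.1 hf α hα)
  obtain ⟨i, hi, hiT⟩ := Set.not_subset.1 hnot
  have h1 : single i 1 ≤ α :=
    single_le_iff.2 (Nat.one_le_iff_ne_zero.2 (Finsupp.mem_support_iff.1 hi))
  obtain ⟨γ, hγ⟩ := exists_add_of_le h1
  have : monomial α (coeff α f) = X i * monomial γ (coeff α f) := by
    rw [X, monomial_mul, one_mul, ← hγ]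
  rw [this, map_mul, restrictVars_X_of_notMem hiT, zero_mul]

lemma restrictVars_empty (f : MvPolynomial σ K) :
    restrictVars K (∅ : Set σ) f = C (constantCoeff f) := by
  have : restrictVars K (∅ : Set σ) = (Algebra.ofId K _).comp (aeval (0 : σ → K)) := by
    ext i : 1
    rw [restrictVars_X_of_notMem (by simp)]
    simp
  rw [this, AlgHom.comp_apply, Algebra.ofId_apply, MvPolynomial.algebraMap_eq, aeval_zero]
  simp

/-- The ideal of the residue classes of the polynomials without constant term. -/
def originIdeal (I : Ideal (MvPolynomial σ K)) : Ideal (MvPolynomial σ K ⧸ I) :=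
  (RingHom.ker (constantCoeff (σ := σ) (R := K))).map (Ideal.Quotient.mk I)

lemma ker_constantCoeff_eq_span :
    RingHom.ker (constantCoeff (σ := σ) (R := K)) = Ideal.span (Set.range X) := by
  ext f
  rw [← Set.image_univ, mem_ideal_span_X_image, RingHom.mem_ker, constantCoeff_eq]
  constructor
  · intro hf α hα
    by_contra! hc
    have : α = 0 := by ext i; exact hc i trivial
    rw [this] at hα
    exact MvPolynomial.mem_support_iff.1 hα hf
  · intro h
    by_contra hc
    obtain ⟨i, -, hi⟩ := h 0 (MvPolynomial.mem_support_iff.2 hc)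
    exact hi rfl

variable {I : Ideal (MvPolynomial σ K)}

lemma mem_originIdeal_iff (hI : IsMonomialIdeal I) (h0 : (0 : σ →₀ ℕ) ∈ standard I)
    (f : MvPolynomial σ K) :
    Ideal.Quotient.mk I f ∈ originIdeal I ↔ constantCoeff f = 0 := by
  have hle : I ≤ RingHom.ker (constantCoeff (σ := σ) (R := K)) := by
    intro g hg
    by_contra hc
    exact h0 (hI.mem_iff.1 hg 0 (MvPolynomial.mem_support_iff.2 hc))
  rw [originIdeal, ← Ideal.mem_comap, Ideal.comap_map_of_surjective _ Ideal.Quotient.mk_surjective,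
    ← RingHom.ker_eq_comap_bot, Ideal.mk_ker, sup_eq_left.2 hle, RingHom.mem_ker]

lemma isMaximal_originIdeal (hI : IsMonomialIdeal I) (h0 : (0 : σ →₀ ℕ) ∈ standard I) :
    (originIdeal I).IsMaximal := by
  have hmax : (RingHom.ker (constantCoeff (σ := σ) (R := K))).IsMaximal :=
    RingHom.ker_isMaximal_of_surjective _ fun c => ⟨C c, constantCoeff_C _ c⟩
  refine (Ideal.map_eq_top_or_isMaximal_of_surjective _ Ideal.Quotient.mk_surjective
    hmax).resolve_left fun htop => ?_
  have : Ideal.Quotient.mk I 1 ∈ originIdeal I := by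
    rw [originIdeal, htop]; trivial
  rw [mem_originIdeal_iff hI h0, map_one] at this
  exact one_ne_zero this

/-- A coordinate plane on which a monomial ideal vanishes gives a chain of three primes. -/
lemma two_le_height_originIdeal (hI : IsMonomialIdeal I) {u v : σ} (huv : u ≠ v)
    (hst : ∀ a c, single u a + single v c ∈ standard I) : 2 ≤ (originIdeal I).height := by
  classical
  have h0 : (0 : σ →₀ ℕ) ∈ standard I := by simpa using hst 0 0
  have hsub : ∀ T ⊆ ({u, v} : Set σ), ∀ f ∈ I, restrictVars K T f = 0 := by
    intro T hT f hf
    refine restrictVars_eq_zero hI (fun α hα => ?_) hf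
    have : α = single u (α u) + single v (α v) := by
      ext i
      by_cases hiu : i = u
      · rw [hiu, Finsupp.add_apply, single_eq_same, single_eq_of_ne huv, add_zero]
      by_cases hiv : i = v
      · rw [hiv, Finsupp.add_apply, single_eq_same, single_eq_of_ne huv.symm, zero_add]
      rw [Finsupp.add_apply, single_eq_of_ne hiu, single_eq_of_ne hiv, add_zero]
      by_contra hc
      have := hT (hα (Finsupp.mem_support_iff.2 hc))
      simp [hiu, hiv] at this
    rw [this]
    exact hst _ _
  let ρ : (T : Set σ) → (hT : T ⊆ {u, v}) → (MvPolynomial σ K ⧸ I) →+* MvPolynomial σ K :=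
    fun T hT => Ideal.Quotient.lift I (restrictVars K T : MvPolynomial σ K →+* _) (hsub T hT)
  have hρ : ∀ T hT f, ρ T hT (Ideal.Quotient.mk I f) = restrictVars K T f := fun T hT f => rfl
  have hlt : ∀ T T' (hT : T ⊆ {u, v}) (hT' : T' ⊆ {u, v}) (i : σ), T' ⊆ T → i ∈ T → i ∉ T' →
      RingHom.ker (ρ T hT) < RingHom.ker (ρ T' hT') := by
    intro T T' hT hT' i hsub hi hi'
    refine lt_of_le_of_ne ?_ fun heq => ?_
    · intro x hx
      obtain ⟨f, rfl⟩ := Ideal.Quotient.mk_surjective x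
      rw [RingHom.mem_ker, hρ T hT] at hx
      rw [RingHom.mem_ker, hρ T' hT']
      rw [← restrictVars_restrictVars hsub, hx, map_zero]
    · have : Ideal.Quotient.mk I (X i) ∈ RingHom.ker (ρ T' hT') := by
        rw [RingHom.mem_ker, hρ T' hT', restrictVars_X_of_notMem hi']
      rw [← heq, RingHom.mem_ker, hρ T hT, restrictVars_X_of_mem hi] at this
      exact X_ne_zero i this
  have h1 := hlt {u, v} {u} subset_rfl (by simp) v (by simp) (by simp) (by simpa using huv.symm)
  have h2 := hlt {u} ∅ (by simp) (by simp) u (by simp) (by simp) (by simp)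
  have heq : originIdeal I = RingHom.ker (ρ ∅ (by simp)) := by
    ext x
    obtain ⟨f, rfl⟩ := Ideal.Quotient.mk_surjective x
    rw [mem_originIdeal_iff hI h0, RingHom.mem_ker, hρ ∅ (by simp), restrictVars_empty, C_eq_zero]
  have p1 : (RingHom.ker (ρ {u, v} subset_rfl)).IsPrime := RingHom.ker_isPrime _
  have p2 : (RingHom.ker (ρ {u} (by simp))).IsPrime := RingHom.ker_isPrime _
  have p3 : (RingHom.ker (ρ ∅ (by simp))).IsPrime := RingHom.ker_isPrime _
  rw [heq]
  have e1 := Ideal.height_add_one_le_of_lt_of_isPrime h1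
  have e2 := Ideal.height_add_one_le_of_lt_of_isPrime h2
  calc (2 : ℕ∞) = 0 + 1 + 1 := by norm_num
    _ ≤ (RingHom.ker (ρ {u, v} subset_rfl)).height + 1 + 1 := by gcongr; exact bot_le
    _ ≤ _ := (add_le_add e1 le_rfl).trans e2

/-- If the quotient by a monomial ideal is Cohen-Macaulay, of dimension at least two at the origin,
then each standard monomial stays standard after multiplication with arbitrary powers of two
suitable variables. -/
lemma exists_ne_forall_mem_standard [Finite σ] (hI : IsMonomialIdeal I)
    (hCM : IsCohenMacaulay (MvPolynomial σ K ⧸ I))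
    {u₀ v₀ : σ} (huv : u₀ ≠ v₀) (hst : ∀ a c, single u₀ a + single v₀ c ∈ standard I)
    {β : σ →₀ ℕ} (hβ : β ∈ standard I) :
    ∃ u v, u ≠ v ∧ ∀ a c, β + single u a + single v c ∈ standard I := by
  by_contra! hcon
  have h0 : (0 : σ →₀ ℕ) ∈ standard I := by simpa using hst 0 0
  have hmax := isMaximal_originIdeal hI h0
  obtain ⟨hnoeth, hloc⟩ := hCM
  let R := Localization.AtPrime (originIdeal I)
  obtain ⟨rs, hrs, hreg, hlen⟩ : ∃ rs : List R, (∀ r ∈ rs, r ∈ IsLocalRing.maximalIdeal R) ∧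
      RingTheory.Sequence.IsRegular R rs ∧ ((rs.length : ℕ∞) : WithBot ℕ∞) = ringKrullDim R :=
    hloc (originIdeal I)
  have : IsNoetherianRing R := IsLocalization.isNoetherianRing (originIdeal I).primeCompl R hnoeth
  have hdim : (2 : ℕ∞) ≤ rs.length := by
    rw [IsLocalization.AtPrime.ringKrullDim_eq_height (originIdeal I) R] at hlen
    rw [WithBot.coe_inj.1 hlen]
    exact two_le_height_originIdeal hI huv hst
  obtain ⟨f, g, rs', rfl⟩ : ∃ f g rs', rs = f :: g :: rs' := by
    match rs, hdim with
    | [], h => simp at h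
    | [_], h => norm_num at h
    | f :: g :: rs', _ => exact ⟨f, g, rs', rfl⟩
  have hreg' := hreg.toIsWeaklyRegular
  rw [RingTheory.Sequence.isWeaklyRegular_cons_iff, RingTheory.Sequence.isWeaklyRegular_cons_iff]
    at hreg'
  let π : MvPolynomial σ K →+* R := (algebraMap _ R).comp (Ideal.Quotient.mk I)
  have hmaxI : IsLocalRing.maximalIdeal R = Ideal.span (Set.range fun i => π (X i)) := by
    refine (Localization.AtPrime.map_eq_maximalIdeal (I := originIdeal I)).symm.trans ?_
    change Ideal.map (algebraMap _ R) ((RingHom.ker (constantCoeff (σ := σ) (R := K))).map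
      (Ideal.Quotient.mk I)) = _
    rw [Ideal.map_map, ker_constantCoeff_eq_span, Ideal.map_span, ← Set.range_comp]
    rfl
  have hne : π (monomial β 1) ≠ 0 := by
    intro hz
    obtain ⟨⟨s, hs⟩, hsβ⟩ := (IsLocalization.map_eq_zero_iff (originIdeal I).primeCompl R _).1 hz
    obtain ⟨s, rfl⟩ := Ideal.Quotient.mk_surjective s
    have hs' : constantCoeff s ≠ 0 := fun h => hs ((mem_originIdeal_iff hI h0 s).2 h)
    have hmem : s * monomial β 1 ∈ I := by
      rw [← Ideal.Quotient.eq_zero_iff_mem, map_mul]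
      exact hsβ
    refine hβ (hI.mem_iff.1 hmem β (MvPolynomial.mem_support_iff.2 ?_))
    have := coeff_mul_monomial (0 : σ →₀ ℕ) β (1 : K) s
    rw [zero_add, mul_one] at this
    rwa [this]
  obtain ⟨p, hass, hle⟩ := exists_le_isAssociatedPrime_of_isNoetherianRing R _ hne
  obtain ⟨hp, y, hpy⟩ := isAssociatedPrime_iff.1 hass
  have hpair : ∀ u v, u ≠ v → π (X u) ∈ p ∨ π (X v) ∈ p := by
    intro u v huv
    obtain ⟨a, c, hac⟩ := hcon u v huv
    have hmem : monomial (β + single u a + single v c) (1 : K) ∈ I := not_not.1 hac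
    have hz : π (X u ^ a * X v ^ c) * π (monomial β 1) = 0 := by
      rw [← map_mul, X_pow_eq_monomial, X_pow_eq_monomial, monomial_mul, monomial_mul, mul_one,
        mul_one, add_comm, ← add_assoc]
      change algebraMap _ R (Ideal.Quotient.mk I _) = 0
      rw [Ideal.Quotient.eq_zero_iff_mem.2 hmem, map_zero]
    have hmem' : π (X u ^ a * X v ^ c) ∈ p := hle (by
      rw [Submodule.mem_colon_singleton]
      exact hz)
    rw [map_mul, map_pow, map_pow] at hmem'
    exact (hp.mem_or_mem hmem').imp (hp.mem_of_pow_mem _) (hp.mem_of_pow_mem _)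
  obtain ⟨w, hw⟩ : ∃ w, ∀ i, i ≠ w → π (X i) ∈ p := by
    by_cases h : ∃ w, π (X w) ∉ p
    · obtain ⟨w, hw⟩ := h
      exact ⟨w, fun i hi => (hpair i w hi).resolve_right hw⟩
    · push Not at h
      exact ⟨u₀, fun i _ => h i⟩
  refine false_of_regular_pair (hrs f (by simp)) (hrs g (by simp)) hreg'.1 hreg'.2.1 (p := p)
    (y := y) (fun r => ?_) (t := π (X w)) ?_ ?_
  · rw [hpy, Submodule.mem_colon_singleton]
    rfl
  · rw [hmaxI]
    exact Ideal.subset_span ⟨w, rfl⟩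
  · rw [hmaxI, Ideal.span_le]
    rintro _ ⟨i, rfl⟩
    by_cases hi : i = w
    · subst hi
      exact Ideal.mem_sup_right (Ideal.mem_span_singleton_self _)
    · exact Ideal.mem_sup_left (hw i hi)

end

/-- If the standard monomials of a Cohen-Macaulay monomial ideal form a section of the bidegree,
then this section is unmixed. -/
lemma isUnmixedSection_standard {K : Type*} [Field K] {d : ℕ} (hd : 0 < d)
    {I : Ideal (MvPolynomial (Fin (d + 1)) K)} (hI : IsMonomialIdeal I)
    (hCM : IsCohenMacaulay (MvPolynomial (Fin (d + 1)) K ⧸ I)) (hsec : IsSection (standard I)) :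
    IsUnmixedSection (standard I) := by
  refine ⟨hsec, standard_of_add, fun α hα => ?_⟩
  obtain ⟨u₀, v₀, huv, hst⟩ := hsec.exists_free_zero hd standard_of_add
  obtain ⟨u, v, hne, h⟩ := exists_ne_forall_mem_standard hI hCM huv.ne
    (by simpa only [zero_add] using hst) hα
  rcases lt_or_gt_of_ne hne with hlt | hlt
  · exact ⟨u, v, hlt, h⟩
  · exact ⟨v, u, hlt, fun a c => by rw [add_right_comm]; exact h c a⟩

/-- A Cohen-Macaulay monomial ideal whose standard monomials form a section of the bidegree is the
quadratic ideal of a set of vertices. -/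
theorem exists_eq_quadricIdeal {K : Type*} [Field K] {d : ℕ} (hd : 0 < d)
    {I : Ideal (MvPolynomial (Fin (d + 1)) K)} (hI : IsMonomialIdeal I)
    (hCM : IsCohenMacaulay (MvPolynomial (Fin (d + 1)) K ⧸ I)) (hsec : IsSection (standard I)) :
    ∃ V : Set (Fin (d + 1)), 0 ∈ V ∧ Fin.last d ∈ V ∧ I = quadricIdeal K V := by
  have hB := isUnmixedSection_standard hd hI hCM hsec
  obtain ⟨U, W, hUW⟩ := hB.exists_isEdgeChoice
  exact ⟨vertices (standard I), hB.zero_mem_vertices hUW, hB.last_mem_vertices hUW,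
    eq_quadricIdeal_of_isSection hI hsec fun α hα => hB.admissible hα⟩

end

/-! ### Finite free algebras over a polynomial ring in two variables -/

section
open Polynomial

/-- Every maximal ideal of `K[X][Y]` contains a regular sequence of length two. -/
lemma exists_regular_pair {K : Type*} [Field K] (n : Ideal K[X][X]) [hn : n.IsMaximal] :
    ∃ f g : K[X][X], f ∈ n ∧ g ∈ n ∧ RingTheory.Sequence.IsWeaklyRegular K[X][X] [f, g] := by
  have hmax : (n.comap (C : K[X] →+* K[X][X])).IsMaximal :=
    Polynomial.isMaximal_comap_C_of_isJacobsonRing n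
  have hne : n.comap (C : K[X] →+* K[X][X]) ≠ ⊥ :=
    Ring.ne_bot_of_isMaximal_of_not_isField hmax (Polynomial.not_isField K)
  obtain ⟨p, hp⟩ := IsPrincipalIdealRing.principal (n.comap (C : K[X] →+* K[X][X]))
  rw [Ideal.submodule_span_eq] at hp
  have hp0 : p ≠ 0 := by
    rintro rfl
    exact hne (hp.trans (by simp))
  have hprime : Prime p := by
    rw [hp] at hmax
    exact (Ideal.span_singleton_prime hp0).1 hmax.isPrime
  have hpn : C p ∈ n := by
    rw [← Ideal.mem_comap, hp]
    exact Ideal.mem_span_singleton_self p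
  -- a polynomial ring is not a field, so `n` is not generated by the constant `p`
  have hg : ∃ g ∈ n, ¬ C p ∣ g := by
    by_contra! hc
    have hX : (X : K[X][X]) ∉ n := fun h => by
      have := (C_dvd_iff_dvd_coeff p X).1 (hc X h) 1
      rw [coeff_X_one] at this
      exact hprime.not_isUnit (isUnit_of_dvd_one this)
    obtain ⟨y, i, hi, hy⟩ := hn.exists_inv hX
    have := (C_dvd_iff_dvd_coeff p i).1 (hc i hi) 0
    have h0 := congrArg (fun q => coeff q 0) hy
    simp only [coeff_add, mul_coeff_zero, coeff_X_zero, mul_zero, zero_add, coeff_one_zero] at h0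
    rw [h0] at this
    exact hprime.not_isUnit (isUnit_of_dvd_one this)
  obtain ⟨g, hgn, hgp⟩ := hg
  have hCp : Prime (C p) := Polynomial.prime_C_iff.2 hprime
  refine ⟨C p, g, hpn, hgn, ?_⟩
  rw [RingTheory.Sequence.isWeaklyRegular_cons_iff, RingTheory.Sequence.isWeaklyRegular_cons_iff]
  refine ⟨fun a b h => mul_left_cancel₀ hCp.ne_zero h, ?_,
    RingTheory.Sequence.IsWeaklyRegular.nil _ _⟩
  refine (isSMulRegular_quotient_iff_mem_of_smul_mem _ _).2 fun x hx => ?_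
  obtain ⟨z, -, hz⟩ := (Submodule.mem_smul_pointwise_iff_exists _ _ _).1 hx
  obtain ⟨w, hw⟩ := (hCp.dvd_or_dvd ⟨z, hz.symm⟩).resolve_left hgp
  exact (Submodule.mem_smul_pointwise_iff_exists _ _ _).2 ⟨w, trivial, hw.symm⟩

lemma ringKrullDim_le_of_isIntegral (R A : Type*) [CommRing R] [CommRing A] [Algebra R A]
    [Algebra.IsIntegral R A] : ringKrullDim A ≤ ringKrullDim R :=
  Order.krullDim_le_of_strictMono (PrimeSpectrum.comap (algebraMap R A)) fun _ _ h =>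
    Ideal.IsIntegral.comap_lt_comap (R := R) h

/-- A finite free algebra over a polynomial ring in two variables over a field is
Cohen-Macaulay. -/
theorem isCohenMacaulay_of_free (K A : Type*) [Field K] [CommRing A] [Algebra K[X][X] A]
    [Module.Finite K[X][X] A] [Module.Free K[X][X] A] : IsCohenMacaulay A := by
  refine ⟨IsNoetherianRing.of_finite K[X][X] A, fun M hM => ?_⟩
  have hnoethA : IsNoetherianRing A := IsNoetherianRing.of_finite K[X][X] A
  let R := Localization.AtPrime M
  have hnoeth : IsNoetherianRing R := IsLocalization.isNoetherianRing M.primeCompl R hnoethA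
  have hn : (M.comap (algebraMap K[X][X] A)).IsMaximal :=
    Ideal.isMaximal_comap_of_isIntegral_of_isMaximal M
  obtain ⟨f, g, hf, hg, hreg⟩ := exists_regular_pair (M.comap (algebraMap K[X][X] A))
  have hregA : RingTheory.Sequence.IsWeaklyRegular A
      ([f, g].map (algebraMap K[X][X] A)) := hreg.of_flat
  have hregR : RingTheory.Sequence.IsRegular R
      (([f, g].map (algebraMap K[X][X] A)).map (algebraMap A R)) := by
    refine hregA.isRegular_of_isLocalization_of_mem R M ?_
    intro r hr
    simp only [List.map_cons, List.map_nil, List.mem_cons, List.not_mem_nil, or_false] at hr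
    rcases hr with rfl | rfl
    · exact hf
    · exact hg
  have hmem : ∀ r ∈ ([f, g].map (algebraMap K[X][X] A)).map (algebraMap A R),
      r ∈ IsLocalRing.maximalIdeal R := by
    intro r hr
    simp only [List.map_cons, List.map_nil, List.mem_cons, List.not_mem_nil, or_false] at hr
    rcases hr with rfl | rfl
    · exact (IsLocalization.AtPrime.to_map_mem_maximal_iff R M _).2 hf
    · exact (IsLocalization.AtPrime.to_map_mem_maximal_iff R M _).2 hg
  refine ⟨_, hmem, hregR, le_antisymm ?_ ?_⟩
  · rw [← ringKrullDim_add_length_eq_ringKrullDim_of_isRegular _ hregR]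
    have : Nontrivial (R ⧸ Ideal.ofList
        (([f, g].map (algebraMap K[X][X] A)).map (algebraMap A R))) := by
      rw [Ideal.Quotient.nontrivial_iff]
      intro htop
      refine (IsLocalRing.maximalIdeal.isMaximal R).ne_top (top_le_iff.1 (htop ▸ ?_))
      exact Ideal.span_le.2 hmem
    exact le_add_of_nonneg_left ringKrullDim_nonneg_of_nontrivial
  · rw [IsLocalization.AtPrime.ringKrullDim_eq_height M R]
    refine (Ideal.height_le_ringKrullDim_of_ne_top hM.ne_top).trans
      ((ringKrullDim_le_of_isIntegral K[X][X] A).trans ?_)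
    rw [Polynomial.ringKrullDim_of_isNoetherianRing, Polynomial.ringKrullDim_of_isNoetherianRing,
      ringKrullDim_eq_zero_of_field]
    simp
    rfl

end

/-! ### Freeness of the quotient by the quadratic ideal -/

section
variable {d : ℕ} (V : Set (Fin (d + 1)))

/-- Two vertices are consecutive if no vertex lies strictly between them. -/
def Consecutive (u v : Fin (d + 1)) : Prop :=
  u ∈ V ∧ v ∈ V ∧ u < v ∧ ∀ w ∈ V, ¬ (u < w ∧ w < v)

open Classical in
/-- The colouring of the vertices in which consecutive vertices have different colours. -/
def colour (s : Fin (d + 1)) : Bool :=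
  decide (Even (Finset.univ.filter fun w : Fin (d + 1) => w ∈ V ∧ w < s).card)

variable {V}

lemma Consecutive.colour_ne {u v : Fin (d + 1)} (h : Consecutive V u v) :
    colour V u ≠ colour V v := by
  classical
  obtain ⟨hu, hv, huv, hno⟩ := h
  have heq : (Finset.univ.filter fun w : Fin (d + 1) => w ∈ V ∧ w < v) =
      insert u (Finset.univ.filter fun w : Fin (d + 1) => w ∈ V ∧ w < u) := by
    ext w
    simp only [Finset.mem_filter, Finset.mem_univ, true_and, Finset.mem_insert]
    constructor
    · rintro ⟨hw, hwv⟩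
      rcases lt_trichotomy w u with h | h | h
      · exact Or.inr ⟨hw, h⟩
      · exact Or.inl h
      · exact absurd ⟨h, hwv⟩ (hno w hw)
    · rintro (rfl | ⟨hw, hwu⟩)
      · exact ⟨hu, huv⟩
      · exact ⟨hw, hwu.trans huv⟩
  have hcard : (Finset.univ.filter fun w : Fin (d + 1) => w ∈ V ∧ w < v).card =
      (Finset.univ.filter fun w : Fin (d + 1) => w ∈ V ∧ w < u).card + 1 := by
    rw [heq, Finset.card_insert_of_notMem (by simp)]
  intro h
  simp only [colour, hcard, Nat.even_add_one, decide_eq_decide] at h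
  tauto

lemma exists_pred (h0 : 0 ∈ V) {s : Fin (d + 1)} (hs : s ≠ 0) :
    ∃ u ∈ V, u < s ∧ ∀ w ∈ V, w < s → w ≤ u := by
  obtain ⟨u, hu, hmax⟩ := Set.exists_max_image {w | w ∈ V ∧ w < s} id (Set.toFinite _)
    ⟨0, h0, Fin.pos_iff_ne_zero.2 hs⟩
  exact ⟨u, hu.1, hu.2, fun w hw hws => hmax w ⟨hw, hws⟩⟩

lemma exists_succ (hd : Fin.last d ∈ V) {s : Fin (d + 1)} (hs : s ≠ Fin.last d) :
    ∃ v ∈ V, s < v ∧ ∀ w ∈ V, s < w → v ≤ w := by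
  obtain ⟨v, hv, hmin⟩ := Set.exists_min_image {w | w ∈ V ∧ s < w} id (Set.toFinite _)
    ⟨Fin.last d, hd, lt_of_le_of_ne (Fin.le_last s) hs⟩
  exact ⟨v, hv.1, hv.2, fun w hw hws => hmin w ⟨hw, hws⟩⟩

/-- Each nonzero vertex is the right end of an interval between consecutive vertices. -/
lemma exists_consecutive_left (h0 : 0 ∈ V) {s : Fin (d + 1)} (hs : s ≠ 0) (hsV : s ∈ V) :
    ∃ u, Consecutive V u s := by
  obtain ⟨u, hu, hus, hmax⟩ := exists_pred h0 hs
  exact ⟨u, hu, hsV, hus, fun w hw h => absurd (hmax w hw h.2) (not_le.2 h.1)⟩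

/-- Each element that is not a vertex lies between consecutive vertices. -/
lemma exists_consecutive_mem (h0 : 0 ∈ V) (hd : Fin.last d ∈ V) {q : Fin (d + 1)} (hq : q ∉ V) :
    ∃ u v, Consecutive V u v ∧ u < q ∧ q < v := by
  obtain ⟨u, hu, huq, hmax⟩ := exists_pred h0 (s := q) (by rintro rfl; exact hq h0)
  obtain ⟨v, hv, hqv, hmin⟩ := exists_succ hd (s := q) (by rintro rfl; exact hq hd)
  refine ⟨u, v, ⟨hu, hv, huq.trans hqv, fun w hw h => ?_⟩, huq, hqv⟩
  rcases lt_trichotomy w q with hlt | rfl | hlt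
  · exact absurd (hmax w hw hlt) (not_le.2 h.1)
  · exact hq hw
  · exact absurd (hmin w hw hlt) (not_le.2 h.2)

variable (K : Type*) [Field K] (V)

/-- The quotient of the polynomial ring by the quadratic ideal of a set of vertices. -/
def QuadricRing : Type _ := MvPolynomial (Fin (d + 1)) K ⧸ quadricIdeal K V

instance : CommRing (QuadricRing V K) :=
  inferInstanceAs (CommRing (MvPolynomial (Fin (d + 1)) K ⧸ quadricIdeal K V))

/-- The quotient map onto the quadric ring. -/
def toQuadricRing : MvPolynomial (Fin (d + 1)) K →+* QuadricRing V K :=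
  Ideal.Quotient.mk (quadricIdeal K V)

/-- The residue class of the variable `t_i`. -/
def var (i : Fin (d + 1)) : QuadricRing V K := toQuadricRing V K (MvPolynomial.X i)

variable {V K}

lemma var_mul_var_of_forbidden {a b : Fin (d + 1)} (h : Forbidden V a b) :
    var V K a * var V K b = 0 := by
  rw [var, var, ← map_mul]
  exact Ideal.Quotient.eq_zero_iff_mem.2 (Ideal.subset_span ⟨a, b, h, rfl⟩)

open Polynomial

variable (K) in
/-- The two variables of `K[X][Y]`, indexed by the colours. -/
def coord : Bool → K[X][X]
  | false => C X
  | true => X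

lemma coord_ne_zero (c : Bool) : coord K c ≠ 0 := by
  cases c
  · exact C_ne_zero.2 X_ne_zero
  · exact X_ne_zero

open Classical in
variable (V K) in
/-- The sum of the vertex variables of a given colour. -/
def colourSum (c : Bool) : QuadricRing V K :=
  ∑ w : Fin (d + 1) with w ∈ V ∧ colour V w = c, var V K w

/-- The quadric ring as an algebra over `K[X][Y]`: the two variables act as the sums of the vertex
variables of each colour, which form a system of parameters. -/
instance : Algebra K[X][X] (QuadricRing V K) :=
  (Polynomial.eval₂RingHom (Polynomial.eval₂RingHom
    ((toQuadricRing V K).comp MvPolynomial.C) (colourSum V K false))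
    (colourSum V K true)).toAlgebra

lemma algebraMap_coord (c : Bool) :
    algebraMap K[X][X] (QuadricRing V K) (coord K c) = colourSum V K c := by
  rw [RingHom.algebraMap_toAlgebra]
  cases c <;> simp [coord]

lemma algebraMap_C_C (k : K) :
    algebraMap K[X][X] (QuadricRing V K) (C (C k)) = toQuadricRing V K (MvPolynomial.C k) := by
  rw [RingHom.algebraMap_toAlgebra]
  simp

open Classical in
lemma coord_smul (c : Bool) (y : QuadricRing V K) : coord K c • y =
    ∑ w : Fin (d + 1) with w ∈ V ∧ colour V w = c, var V K w * y := by
  rw [Algebra.smul_def, algebraMap_coord, colourSum, Finset.sum_mul]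

/-- Multiplication of `y` with a vertex variable is, up to the action of a variable of `K[X][Y]`,
minus the multiplication with the other vertex variables of the same colour. -/
lemma var_mul_mem {v : Fin (d + 1)} (hv : v ∈ V) (y : QuadricRing V K)
    (N : Submodule K[X][X] (QuadricRing V K)) (hy : y ∈ N)
    (h : ∀ w ∈ V, w ≠ v → colour V w = colour V v → var V K w * y ∈ N) : var V K v * y ∈ N := by
  classical
  have hmem := N.smul_mem (coord K (colour V v)) hy
  rw [coord_smul, ← Finset.add_sum_erase _ _ (a := v) (by simp [hv])] at hmem
  refine (N.add_mem_iff_left (N.sum_mem fun w hw => ?_)).1 hmem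
  rw [Finset.mem_erase, Finset.mem_filter] at hw
  exact h w hw.2.2.1 hw.1 hw.2.2.2

/-- A submodule over `K[X][Y]` spanned by variables and `1` is everything if it contains `1` and all
variables except for those of the first two vertices. -/
lemma eq_top_of_var_mem {v₁ : Fin (d + 1)} (hv₁ : Consecutive V 0 v₁)
    {N : Submodule K[X][X] (QuadricRing V K)} {s : Set (QuadricRing V K)}
    (hN : N = Submodule.span K[X][X] s) (hs : ∀ x ∈ s, x = 1 ∨ ∃ i, x = var V K i) (hone : 1 ∈ N)
    (hvar : ∀ i, i ≠ 0 → i ≠ v₁ → var V K i ∈ N) : N = ⊤ := by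
  have hvar' : ∀ i, var V K i ∈ N := by
    intro i
    by_cases hi : i = 0 ∨ i = v₁
    · have hiV : i ∈ V := hi.elim (fun h => h ▸ hv₁.1) fun h => h ▸ hv₁.2.1
      have := var_mul_mem hiV 1 N hone fun w hw hwi hc => by
        rw [mul_one]
        have hne := hv₁.colour_ne
        refine hvar w ?_ ?_
        · rintro rfl
          rcases hi with rfl | rfl
          · exact hwi rfl
          · exact hne hc
        · rintro rfl
          rcases hi with rfl | rfl
          · exact hne hc.symm
          · exact hwi rfl
      rwa [mul_one] at this
    · push Not at hi
      exact hvar i hi.1 hi.2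
  have hforb : ∀ {a b}, Forbidden V a b → var V K a * var V K b ∈ N := fun h => by
    rw [var_mul_var_of_forbidden h]
    exact N.zero_mem
  -- products of two distinct vertices, by induction on the smaller one
  have hVV : ∀ i, i ∈ V → ∀ j ∈ V, i < j → var V K j * var V K i ∈ N := by
    intro i
    induction i using WellFoundedLT.induction with
    | _ i ih =>
      intro hi j hj hij
      by_cases hcons : Consecutive V i j
      · refine var_mul_mem hj _ N (hvar' i) fun w hw hwj hc => ?_
        rcases lt_trichotomy w i with hlt | rfl | hlt
        · rw [mul_comm]
          exact ih w hlt hw i hi hlt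
        · exact absurd hc hcons.colour_ne
        · rw [mul_comm]
          have : j < w := lt_of_le_of_ne (not_lt.1 fun h => hcons.2.2.2 w hw ⟨hlt, h⟩) hwj.symm
          exact hforb ⟨hlt.le, Or.inl ⟨j, hj, hij, this⟩⟩
      · simp only [Consecutive, hi, hj, hij, true_and, not_forall, not_not] at hcons
        obtain ⟨w, hw, h⟩ := hcons
        rw [mul_comm]
        exact hforb ⟨hij.le, Or.inl ⟨w, hw, h⟩⟩
  have hne_of : ∀ i w w', i ∉ V → w ∈ V → w' ∈ V → w < w' → colour V w = colour V w' →
      (i < w → Forbidden V i w') ∧ (w' < i → Forbidden V w i) ∧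
        (w < i → i < w' → Forbidden V w i ∨ Forbidden V i w') := by
    intro i w w' hi hw hw' hlt hc
    refine ⟨fun h => ⟨(h.trans hlt).le, Or.inl ⟨w, hw, h, hlt⟩⟩,
      fun h => ⟨(hlt.trans h).le, Or.inl ⟨w', hw', hlt, h⟩⟩, fun h h' => ?_⟩
    by_contra! hcon
    refine Consecutive.colour_ne ⟨hw, hw', hlt, fun x hx hxx => ?_⟩ hc
    rcases lt_trichotomy x i with hxi | rfl | hxi
    · exact hcon.1 ⟨h.le, Or.inl ⟨x, hx, hxx.1, hxi⟩⟩
    · exact hi hx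
    · exact hcon.2 ⟨h'.le, Or.inl ⟨x, hx, hxi, hxx.2⟩⟩
  have hsymm : ∀ {a b}, (Forbidden V a b ∨ Forbidden V b a) → var V K a * var V K b ∈ N := by
    rintro a b (h | h)
    · exact hforb h
    · rw [mul_comm]; exact hforb h
  -- products of a vertex and a variable that is not a vertex
  have hQV : ∀ i, i ∉ V → ∀ w ∈ V, var V K w * var V K i ∈ N := by
    intro i hi w hw
    by_cases hf : Forbidden V w i ∨ Forbidden V i w
    · exact hsymm hf
    push Not at hf
    refine var_mul_mem hw _ N (hvar' i) fun w' hw' hne hc => hsymm ?_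
    have hiw : i ≠ w := by rintro rfl; exact hi hw
    have hiw' : i ≠ w' := by rintro rfl; exact hi hw'
    rcases lt_or_gt_of_ne hne with hlt | hlt
    · obtain ⟨h1, h2, h3⟩ := hne_of i w' w hi hw' hw hlt hc
      rcases lt_or_gt_of_ne hiw' with h | h
      · exact absurd (h1 h) hf.2
      · rcases lt_or_gt_of_ne hiw with h' | h'
        · exact Or.inl ((h3 h h').resolve_right hf.2)
        · exact Or.inl (h2 h')
    · obtain ⟨h1, h2, h3⟩ := hne_of i w w' hi hw hw' hlt hc.symm
      rcases lt_or_gt_of_ne hiw with h | h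
      · exact Or.inr (h1 h)
      · rcases lt_or_gt_of_ne hiw' with h' | h'
        · exact Or.inr ((h3 h h').resolve_left hf.1)
        · exact absurd (h2 h') hf.1
  have hprod : ∀ i j, var V K i * var V K j ∈ N := by
    intro i j
    wlog hij : i ≤ j generalizing i j
    · rw [mul_comm]
      exact this j i (not_le.1 hij).le
    by_cases hi : i ∈ V
    · by_cases hj : j ∈ V
      · rcases hij.eq_or_lt with rfl | hlt
        · refine var_mul_mem hi _ N (hvar' i) fun w hw hwi _ => ?_
          rcases lt_or_gt_of_ne hwi with h | h
          · rw [mul_comm]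
            exact hVV w hw i hi h
          · exact hVV i hi w hw h
        · rw [mul_comm]
          exact hVV i hi j hj hlt
      · exact hQV j hj i hi
    · by_cases hj : j ∈ V
      · rw [mul_comm]
        exact hQV i hi j hj
      · by_cases hf : Forbidden V i j
        · exact hforb hf
        · exfalso
          simp only [Forbidden, hij, true_and, not_or, not_forall, not_not] at hf
          obtain ⟨hno, w, hw, hle⟩ := hf
          refine hno ⟨w, hw, lt_of_le_of_ne hle.1 ?_, lt_of_le_of_ne hle.2 ?_⟩
          · rintro rfl; exact hi hw
          · rintro rfl; exact hj hw
  have hclosed : ∀ i, ∀ x ∈ N, x * var V K i ∈ N := by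
    intro i x hx
    have hx' : x ∈ Submodule.span K[X][X] s := hN ▸ hx
    induction hx' using Submodule.span_induction with
    | mem x hxs =>
      rcases hs x hxs with rfl | ⟨j, rfl⟩
      · rw [one_mul]; exact hvar' i
      · exact hprod j i
    | zero => rw [zero_mul]; exact N.zero_mem
    | add x y hx₁ hy₁ ihx ihy =>
      rw [add_mul]
      exact N.add_mem (ihx (by rwa [hN])) (ihy (by rwa [hN]))
    | smul r x hx₁ ihx =>
      rw [smul_mul_assoc]
      exact N.smul_mem r (ihx (by rwa [hN]))
  rw [eq_top_iff]
  rintro x -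
  obtain ⟨f, rfl⟩ : ∃ f, toQuadricRing V K f = x := Ideal.Quotient.mk_surjective x
  induction f using MvPolynomial.induction_on with
  | C k =>
    rw [← algebraMap_C_C, Algebra.algebraMap_eq_smul_one]
    exact N.smul_mem _ hone
  | add f g hf hg => rw [map_add]; exact N.add_mem hf hg
  | mul_X f i hf => rw [map_mul]; exact hclosed i _ hf

/-! ### Restriction to thickened edges -/

variable (d K) in
/-- The square-zero extension of `K[X][Y]` by one copy of `K[X][Y]` for each variable. -/
abbrev EdgeRing : Type _ := TrivSqZeroExt K[X][X] (Fin (d + 1) → K[X][X])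

open Classical in
variable (V K) in
/-- The value of the variable `t_i` on the edge `u, v`: the ends become the two variables of
`K[X][Y]`, the variables in between become infinitesimal, and the others vanish. -/
def edgeValue (u v i : Fin (d + 1)) : EdgeRing d K :=
  if i = u ∨ i = v then TrivSqZeroExt.inl (coord K (colour V i))
  else if u < i ∧ i < v then TrivSqZeroExt.inr (Pi.single i 1) else 0

lemma edgeValue_mul_edgeValue {u v : Fin (d + 1)} (h : Consecutive V u v) {a b : Fin (d + 1)}
    (hab : Forbidden V a b) : edgeValue V K u v a * edgeValue V K u v b = 0 := by
  obtain ⟨hu, hv, huv, hno⟩ := h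
  obtain ⟨hle, hab⟩ := hab
  have hout : ∀ {i}, ¬ (u ≤ i ∧ i ≤ v) → edgeValue V K u v i = 0 := by
    intro i hi
    rw [edgeValue, if_neg, if_neg]
    · exact fun h => hi ⟨h.1.le, h.2.le⟩
    · rintro (rfl | rfl)
      · exact hi ⟨le_rfl, huv.le⟩
      · exact hi ⟨huv.le, le_rfl⟩
  by_cases ha : u ≤ a ∧ a ≤ v
  swap
  · rw [hout ha, zero_mul]
  by_cases hb : u ≤ b ∧ b ≤ v
  swap
  · rw [hout hb, mul_zero]
  rcases hab with ⟨w, hw, h1, h2⟩ | hab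
  · exact absurd ⟨ha.1.trans_lt h1, h2.trans_le hb.2⟩ (hno w hw)
  · have ha' : ¬ (a = u ∨ a = v) := by
      rintro (rfl | rfl)
      · exact hab a hu ⟨le_rfl, hle⟩
      · exact hab a hv ⟨le_rfl, hle⟩
    have hb' : ¬ (b = u ∨ b = v) := by
      rintro (rfl | rfl)
      · exact hab b hu ⟨hle, le_rfl⟩
      · exact hab b hv ⟨hle, le_rfl⟩
    rw [edgeValue, edgeValue, if_neg ha', if_neg hb']
    push Not at ha' hb'
    rw [if_pos ⟨lt_of_le_of_ne ha.1 ha'.1.symm, lt_of_le_of_ne ha.2 ha'.2⟩,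
      if_pos ⟨lt_of_le_of_ne hb.1 hb'.1.symm, lt_of_le_of_ne hb.2 hb'.2⟩,
      TrivSqZeroExt.inr_mul_inr]

/-- The restriction to a thickened edge. -/
def edgeHom {u v : Fin (d + 1)} (h : Consecutive V u v) : QuadricRing V K →+* EdgeRing d K :=
  Ideal.Quotient.lift (quadricIdeal K V)
    (MvPolynomial.eval₂Hom ((TrivSqZeroExt.inlHom K[X][X] (Fin (d + 1) → K[X][X])).comp
      (C.comp C)) (edgeValue V K u v)) fun f hf => by
    have hle : quadricIdeal K V ≤ RingHom.ker (MvPolynomial.eval₂Hom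
        ((TrivSqZeroExt.inlHom K[X][X] (Fin (d + 1) → K[X][X])).comp (C.comp C))
        (edgeValue V K u v)) := by
      refine Ideal.span_le.2 ?_
      rintro _ ⟨a, b, hab, rfl⟩
      rw [SetLike.mem_coe, RingHom.mem_ker, map_mul, MvPolynomial.eval₂Hom_X',
        MvPolynomial.eval₂Hom_X', edgeValue_mul_edgeValue h hab]
    exact hle hf

lemma edgeHom_var {u v : Fin (d + 1)} (h : Consecutive V u v) (i : Fin (d + 1)) :
    edgeHom h (var V K i) = edgeValue V K u v i :=
  MvPolynomial.eval₂Hom_X' _ _ _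

lemma edgeHom_colourSum {u v : Fin (d + 1)} (h : Consecutive V u v) (c : Bool) :
    edgeHom h (colourSum V K c) = TrivSqZeroExt.inl (coord K c) := by
  classical
  have hval : ∀ w ∈ V, w ≠ u → w ≠ v → edgeValue V K u v w = 0 := by
    intro w hw hwu hwv
    rw [edgeValue, if_neg (by tauto), if_neg (h.2.2.2 w hw)]
  have hne := h.colour_ne
  obtain ⟨z, hz, hzV, hzc, hzu⟩ : ∃ z, (z = u ∨ z = v) ∧ z ∈ V ∧ colour V z = c ∧
      ∀ w, colour V w = c → w ≠ z → w ≠ u ∧ w ≠ v := by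
    by_cases hc : colour V u = c
    · refine ⟨u, Or.inl rfl, h.1, hc, fun w hw hwu => ⟨hwu, ?_⟩⟩
      rintro rfl
      exact hne (hc.trans hw.symm)
    · refine ⟨v, Or.inr rfl, h.2.1, ?_, fun w hw hwv => ⟨?_, hwv⟩⟩
      · revert hc hne
        cases colour V u <;> cases colour V v <;> cases c <;> simp
      · rintro rfl
        exact hc hw
  rw [colourSum, map_sum, Finset.sum_eq_single z]
  · rw [edgeHom_var, edgeValue, if_pos hz, hzc]
  · intro w hw hwz
    rw [Finset.mem_filter] at hw
    rw [edgeHom_var, hval w hw.2.1 (hzu w hw.2.2 hwz).1 (hzu w hw.2.2 hwz).2]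
  · intro hn
    exact absurd (by simp [hzV, hzc]) hn

lemma edgeHom_smul {u v : Fin (d + 1)} (h : Consecutive V u v) (p : K[X][X])
    (y : QuadricRing V K) : edgeHom h (p • y) = p • edgeHom h y := by
  have key : (edgeHom h).comp (algebraMap K[X][X] (QuadricRing V K)) =
      TrivSqZeroExt.inlHom K[X][X] (Fin (d + 1) → K[X][X]) := by
    refine Polynomial.ringHom_ext' (Polynomial.ringHom_ext' ?_ ?_) ?_
    · ext k : 1
      simp only [RingHom.comp_apply, algebraMap_C_C]
      exact MvPolynomial.eval₂Hom_C _ _ _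
    · simp only [RingHom.comp_apply]
      exact (congrArg _ (algebraMap_coord false)).trans (edgeHom_colourSum h false)
    · simp only [RingHom.comp_apply]
      exact (congrArg _ (algebraMap_coord true)).trans (edgeHom_colourSum h true)
  rw [Algebra.smul_def, map_mul, ← RingHom.comp_apply, key]
  exact TrivSqZeroExt.inl_mul_eq_smul _ _

variable (V K) in
/-- The family, indexed by the nonzero elements of `{0, …, d}`, that consists of `1`, at the index
of the vertex `v₁` next to `0`, and of the variables other than `t_0` and `t_{v₁}`. -/
def basisFamily (v₁ : Fin (d + 1)) (s : {s : Fin (d + 1) // s ≠ 0}) : QuadricRing V K :=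
  if (s : Fin (d + 1)) = v₁ then 1 else var V K s

lemma span_basisFamily {v₁ : Fin (d + 1)} (hv₁ : Consecutive V 0 v₁) :
    Submodule.span K[X][X] (Set.range (basisFamily V K v₁)) = ⊤ := by
  refine eq_top_of_var_mem hv₁ rfl ?_ ?_ ?_
  · rintro _ ⟨s, rfl⟩
    rw [basisFamily]
    split_ifs
    · exact Or.inl rfl
    · exact Or.inr ⟨s, rfl⟩
  · exact Submodule.subset_span ⟨⟨v₁, hv₁.2.2.1.ne'⟩, by rw [basisFamily, if_pos rfl]⟩
  · exact fun i hi0 hi => Submodule.subset_span ⟨⟨i, hi0⟩, by rw [basisFamily, if_neg hi]⟩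

/-- Linear independence is tested on the thickened edges: on the edge `u, v`, the infinitesimal part
gives the coefficients of the variables strictly between `u` and `v`; the other part gives
the coefficient at `v` once the one at `u` is known to vanish. -/
lemma linearIndependent_basisFamily (h0 : 0 ∈ V) (hd : Fin.last d ∈ V) {v₁ : Fin (d + 1)}
    (hv₁ : Consecutive V 0 v₁) : LinearIndependent K[X][X] (basisFamily V K v₁) := by
  classical
  rw [Fintype.linearIndependent_iff]
  intro g hg
  have hedge : ∀ {u v : Fin (d + 1)} (h : Consecutive V u v),
      ∑ s, g s • edgeHom h (basisFamily V K v₁ s) = 0 := by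
    intro u v h
    have := congrArg (edgeHom h) hg
    rw [map_sum, map_zero] at this
    simpa only [edgeHom_smul] using this
  have hval : ∀ {u v : Fin (d + 1)} (h : Consecutive V u v) (s : {s : Fin (d + 1) // s ≠ 0}),
      edgeHom h (basisFamily V K v₁ s) =
        if (s : Fin (d + 1)) = v₁ then 1 else edgeValue V K u v s := by
    intro u v h s
    rw [basisFamily]
    split_ifs
    · rw [map_one]
    · rw [edgeHom_var]
  have hV : ∀ s : Fin (d + 1), ∀ hs : s ≠ 0, s ∈ V → g ⟨s, hs⟩ = 0 := by
    intro s
    induction s using WellFoundedLT.induction with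
    | _ s ih =>
      intro hs hsV
      obtain ⟨u, hu⟩ := exists_consecutive_left h0 hs hsV
      have hsum := congrArg TrivSqZeroExt.fst (hedge hu)
      rw [TrivSqZeroExt.fst_sum, Finset.sum_eq_single (⟨s, hs⟩ : {s : Fin (d + 1) // s ≠ 0})]
        at hsum
      · rw [hval, TrivSqZeroExt.fst_smul, TrivSqZeroExt.fst_zero, smul_eq_mul, mul_eq_zero] at hsum
        refine hsum.resolve_right ?_
        split_ifs with hsv
        · simp
        · rw [edgeValue, if_pos (Or.inr rfl), TrivSqZeroExt.fst_inl]
          exact coord_ne_zero _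
      · rintro ⟨i, hi⟩ - his
        have his' : i ≠ s := fun h => his (Subtype.ext h)
        rw [hval]
        by_cases hlt : i < s ∧ i ∈ V
        · rw [ih i hlt.1 hi hlt.2, zero_smul, TrivSqZeroExt.fst_zero]
        · have hiv : i ≠ v₁ := by
            rintro rfl
            refine hlt ⟨lt_of_le_of_ne (not_lt.1 fun h => ?_) his', hv₁.2.1⟩
            exact hv₁.2.2.2 s hsV ⟨Fin.pos_iff_ne_zero.2 hs, h⟩
          have hiu : i ≠ u := by
            rintro rfl
            exact hlt ⟨hu.2.2.1, hu.1⟩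
          simp only [if_neg hiv]
          rw [edgeValue, if_neg (by tauto)]
          split_ifs <;> simp
      · exact fun h => absurd (Finset.mem_univ _) h
  rintro ⟨q, hq⟩
  by_cases hqV : q ∈ V
  · exact hV q hq hqV
  obtain ⟨u, v, h, huq, hqv⟩ := exists_consecutive_mem h0 hd hqV
  have hsum := congrFun (congrArg TrivSqZeroExt.snd (hedge h)) q
  rw [TrivSqZeroExt.snd_sum, Finset.sum_apply,
    Finset.sum_eq_single (⟨q, hq⟩ : {s : Fin (d + 1) // s ≠ 0})] at hsum
  · have hqv₁ : q ≠ v₁ := by rintro rfl; exact hqV hv₁.2.1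
    rw [hval, TrivSqZeroExt.snd_smul, if_neg hqv₁, edgeValue, if_neg, if_pos ⟨huq, hqv⟩] at hsum
    · simpa using hsum
    · rintro (h' | h')
      · exact huq.ne' h'
      · exact hqv.ne h'
  · rintro ⟨i, hi⟩ - hiq
    have hiq' : q ≠ i := fun h => hiq (Subtype.ext h.symm)
    rw [hval, TrivSqZeroExt.snd_smul, Pi.smul_apply]
    split_ifs with h1
    · simp
    · rw [edgeValue]
      split_ifs <;> simp [hiq']
  · exact fun h => absurd (Finset.mem_univ _) h

/-- The quotient by the quadratic ideal of a set of vertices containing `0` and `d` is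
Cohen-Macaulay. -/
theorem isCohenMacaulay_quadricIdeal (K : Type*) [Field K] (hpos : 0 < d) (h0 : 0 ∈ V)
    (hd : Fin.last d ∈ V) : IsCohenMacaulay (MvPolynomial (Fin (d + 1)) K ⧸ quadricIdeal K V) := by
  have hne : (0 : Fin (d + 1)) ≠ Fin.last d := by
    intro h
    have := congrArg Fin.val h
    simp at this
    omega
  obtain ⟨v₁, hv₁, h0v, hmin⟩ := exists_succ hd hne
  have hcons : Consecutive V 0 v₁ :=
    ⟨h0, hv₁, h0v, fun w hw h => absurd (hmin w hw h.1) (not_le.2 h.2)⟩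
  let b := Module.Basis.mk (linearIndependent_basisFamily (K := K) h0 hd hcons)
    (span_basisFamily hcons).ge
  have : Module.Free K[X][X] (QuadricRing V K) := Module.Free.of_basis b
  have : Module.Finite K[X][X] (QuadricRing V K) := Module.Finite.of_basis b
  exact isCohenMacaulay_of_free K (QuadricRing V K)

end

section
open MvPolynomial

/-! ### Subdivisions and the ideals attached to them -/

section
variable {d k : ℕ} {i : Fin (k + 1) → Fin (d + 1)}

lemma IsSubdivision.zero_mem (hi : IsSubdivision d k i) : 0 ∈ Set.range i := ⟨0, hi.2.1⟩

lemma IsSubdivision.last_mem (hi : IsSubdivision d k i) : Fin.last d ∈ Set.range i :=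
  ⟨Fin.last k, hi.2.2⟩

/-- There is no term of a subdivision strictly between two successive ones. -/
lemma IsSubdivision.not_lt_of_lt (hi : IsSubdivision d k i) {j : Fin k} {l : Fin (k + 1)}
    (h1 : i j.castSucc < i l) : ¬ i l < i j.succ := by
  intro h2
  have h3 := hi.1.lt_iff_lt.1 h1
  have h4 := hi.1.lt_iff_lt.1 h2
  simp only [Fin.lt_def, Fin.val_castSucc, Fin.val_succ] at h3 h4
  omega

lemma IsSubdivision.exists_between (hi : IsSubdivision d k i) {s : Fin (d + 1)}
    (hs : s ∉ Set.range i) : ∃ j : Fin k, i j.castSucc < s ∧ s < i j.succ := by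
  obtain ⟨m, hm, hmax⟩ := Set.exists_max_image {j | i j < s} id (Set.toFinite _)
    ⟨0, lt_of_le_of_ne (hi.2.1 ▸ Fin.zero_le s) fun h => hs ⟨0, h⟩⟩
  have hmk : m ≠ Fin.last k := by
    rintro rfl
    have : i (Fin.last k) < s := hm
    rw [hi.2.2] at this
    exact absurd (Fin.le_last s) (not_le.2 this)
  refine ⟨m.castPred hmk, by rwa [Fin.castSucc_castPred], ?_⟩
  by_contra hc
  have h1 : i (m.castPred hmk).succ < s := lt_of_le_of_ne (not_lt.1 hc) fun h => hs ⟨_, h⟩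
  have h2 : (m.castPred hmk).succ ≤ m := hmax _ h1
  simp only [Fin.le_def, Fin.val_succ, Fin.coe_castPred] at h2
  omega

lemma IsSubdivision.eq_of_between (hi : IsSubdivision d k i) {s : Fin (d + 1)} {j j' : Fin k}
    (h1 : i j.castSucc < s) (h2 : s < i j.succ) (h1' : i j'.castSucc < s) (h2' : s < i j'.succ) :
    j = j' := by
  have h3 := hi.1.lt_iff_lt.1 (h1.trans h2')
  have h4 := hi.1.lt_iff_lt.1 (h1'.trans h2)
  simp only [Fin.lt_def, Fin.val_castSucc, Fin.val_succ] at h3 h4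
  exact Fin.ext (by omega)

/-- Each set containing `0` and `d` is the set of terms of a subdivision. -/
lemma exists_isSubdivision {V : Set (Fin (d + 1))} (h0 : 0 ∈ V) (hd : Fin.last d ∈ V) :
    ∃ (k : ℕ) (i : Fin (k + 1) → Fin (d + 1)), IsSubdivision d k i ∧ Set.range i = V := by
  classical
  have hcard : V.toFinset.card = (V.toFinset.card - 1) + 1 :=
    (Nat.sub_add_cancel (Finset.card_pos.2 ⟨0, Set.mem_toFinset.2 h0⟩)).symm
  let e := V.toFinset.orderEmbOfFin hcard
  have hrange : Set.range e = V := by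
    rw [Finset.range_orderEmbOfFin, Set.coe_toFinset]
  refine ⟨V.toFinset.card - 1, e, ⟨e.strictMono, ?_, ?_⟩, hrange⟩
  · obtain ⟨l, hl⟩ : (0 : Fin (d + 1)) ∈ Set.range e := by rw [hrange]; exact h0
    exact le_antisymm (hl ▸ e.monotone (Fin.zero_le l)) (Fin.zero_le _)
  · obtain ⟨l, hl⟩ : Fin.last d ∈ Set.range e := by rw [hrange]; exact hd
    exact le_antisymm (Fin.le_last _) (hl ▸ e.monotone (Fin.le_last l))

variable (K : Type*) [Field K]

lemma diagonalIdeal_eq_quadricIdeal (hi : IsSubdivision d k i) :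
    diagonalIdeal K i = quadricIdeal K (Set.range i) := by
  rw [diagonalIdeal, quadricIdeal]
  congr 1
  ext g
  constructor
  · rintro (⟨v, r, ⟨j, h1, h2⟩, rfl⟩ | ⟨v, r, ⟨j, h1, h2, h3⟩, rfl⟩)
    · have ha : v.castSucc < i j := by rw [Fin.lt_def, Fin.val_castSucc]; omega
      have hb : i j < r.succ := by rw [Fin.lt_def, Fin.val_succ]; omega
      exact ⟨v.castSucc, r.succ, ⟨(ha.trans hb).le, Or.inl ⟨i j, ⟨j, rfl⟩, ha, hb⟩⟩,
        by simp [hankel]⟩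
    · have ha : i j.castSucc < v.succ := by rw [Fin.lt_def, Fin.val_succ]; omega
      have hb : r.castSucc < i j.succ := by rw [Fin.lt_def, Fin.val_castSucc]; omega
      have hab : v.succ ≤ r.castSucc := by
        rw [Fin.le_def, Fin.val_succ, Fin.val_castSucc]
        exact h2
      refine ⟨v.succ, r.castSucc, ⟨hab, Or.inr ?_⟩, by simp [hankel]⟩
      rintro _ ⟨l, rfl⟩ ⟨h4, h5⟩
      exact hi.not_lt_of_lt (ha.trans_le h4) (h5.trans_lt hb)
  · rintro ⟨a, b, ⟨hab, ⟨_, ⟨j, rfl⟩, h1, h2⟩ | hno⟩, rfl⟩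
    · left
      have hal : a ≠ Fin.last d := ((h1.trans h2).trans_le (Fin.le_last b)).ne
      have hb0 : b ≠ 0 := ((Fin.zero_le a).trans_lt (h1.trans h2)).ne'
      refine ⟨a.castPred hal, b.pred hb0, ⟨j, ?_, ?_⟩, by simp [hankel]⟩
      · rw [Fin.coe_castPred]
        exact h1
      · rw [Fin.val_pred]
        have : (i j : ℕ) < b := h2
        omega
    · right
      have ha : a ∉ Set.range i := fun h => hno a h ⟨le_rfl, hab⟩
      obtain ⟨j, h1, h2⟩ := hi.exists_between ha
      have hb : b < i j.succ := by
        by_contra hc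
        exact hno _ ⟨_, rfl⟩ ⟨h2.le, not_lt.1 hc⟩
      have ha0 : a ≠ 0 := ((Fin.zero_le _).trans_lt h1).ne'
      have hbl : b ≠ Fin.last d := (hb.trans_le (Fin.le_last _)).ne
      have h1' : (i j.castSucc : ℕ) < a := h1
      have hb' : (b : ℕ) < i j.succ := hb
      have hab' : (a : ℕ) ≤ b := hab
      refine ⟨a.pred ha0, b.castPred hbl, ⟨j, ?_, ?_, ?_⟩, by simp [hankel]⟩
      · rw [Fin.val_pred]; omega
      · rw [Fin.lt_def, Fin.val_pred, Fin.coe_castPred]; omega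
      · rw [Fin.coe_castPred]; omega

lemma X_mul_X_mem_quadricIdeal {V : Set (Fin (d + 1))} {a b : Fin (d + 1)}
    (h : Forbidden V a b) : (X a * X b : MvPolynomial (Fin (d + 1)) K) ∈ quadricIdeal K V :=
  Ideal.subset_span ⟨a, b, h, rfl⟩

lemma mem_lineEdge {j : Fin k} {v : Set.range i} :
    v ∈ lineEdge i j ↔ (v : Fin (d + 1)) = i j.castSucc ∨ (v : Fin (d + 1)) = i j.succ := by
  rw [lineEdge, Sym2.mem_iff, Subtype.ext_iff, Subtype.ext_iff]

lemma lineGraph_adj_iff {x y : Set.range i} :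
    (lineGraph i).Adj x y ↔ (∃ j, lineEdge i j = s(x, y)) ∧ x ≠ y := by
  rw [lineGraph, SimpleGraph.fromEdgeSet_adj, Set.mem_range]

/-- Two vertices of the line are adjacent if and only if no vertex separates them. -/
lemma IsSubdivision.adj_iff (hi : IsSubdivision d k i) {x y : Set.range i} (hxy : x < y) :
    (lineGraph i).Adj x y ↔
      ¬ ∃ w ∈ Set.range i, (x : Fin (d + 1)) < w ∧ w < (y : Fin (d + 1)) := by
  rw [lineGraph_adj_iff]
  constructor
  · rintro ⟨⟨j, hj⟩, -⟩ ⟨_, ⟨l, rfl⟩, h1, h2⟩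
    have hx : x ∈ lineEdge i j := hj ▸ Sym2.mem_mk_left x y
    have hy : y ∈ lineEdge i j := hj ▸ Sym2.mem_mk_right x y
    rw [mem_lineEdge] at hx hy
    have hlt : (x : Fin (d + 1)) < y := hxy
    have hj' : i j.castSucc < i j.succ := hi.1 (Fin.castSucc_lt_succ)
    rcases hx with hx | hx <;> rcases hy with hy | hy <;> rw [hx] at h1 hlt <;> rw [hy] at h2 hlt
    · exact lt_irrefl _ hlt
    · exact hi.not_lt_of_lt h1 h2
    · exact lt_asymm hlt hj'
    · exact lt_irrefl _ hlt
  · intro h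
    refine ⟨?_, hxy.ne⟩
    obtain ⟨_, l, rfl⟩ := x
    obtain ⟨_, m, rfl⟩ := y
    have hlm : l < m := hi.1.lt_iff_lt.1 hxy
    have hl : l ≠ Fin.last k := (hlm.trans_le (Fin.le_last m)).ne
    have hsucc : (l.castPred hl).succ = m := by
      by_contra hne
      refine h ⟨_, ⟨(l.castPred hl).succ, rfl⟩, hi.1 ?_, hi.1 ?_⟩
      · rw [Fin.lt_def, Fin.val_succ, Fin.coe_castPred]; omega
      · refine lt_of_le_of_ne ?_ hne
        rw [Fin.le_def, Fin.val_succ, Fin.coe_castPred]; omega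
    refine ⟨l.castPred hl, ?_⟩
    rw [lineEdge]
    congr 2
    rw [hsucc]

lemma treeIdeal_eq_quadricIdeal (hi : IsSubdivision d k i)
    {φ : ((Set.range i)ᶜ : Set (Fin (d + 1))) → (lineGraph i).edgeSet} (hφ : IsLineMap i φ) :
    treeIdeal K (lineGraph i) φ = quadricIdeal K (Set.range i) := by
  have hsep : ∀ {a w b : Fin (d + 1)}, w ∈ Set.range i → a < w → w < b →
      (X a * X b : MvPolynomial (Fin (d + 1)) K) ∈ quadricIdeal K (Set.range i) :=
    fun hw h1 h2 => X_mul_X_mem_quadricIdeal K ⟨(h1.trans h2).le, Or.inl ⟨_, hw, h1, h2⟩⟩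
  apply le_antisymm
  · refine sup_le ?_ (sup_le ?_ ?_)
    · refine Ideal.span_le.2 ?_
      rintro _ (⟨x, y, hne, hadj, rfl⟩ | ⟨⟨x, hx⟩, ⟨y, hy⟩, ⟨z, hz⟩, hxy, hxz, hyz, rfl⟩)
      · rw [SetLike.mem_coe]
        wlog hlt : x < y generalizing x y
        · rw [mul_comm]
          exact this y x hne.symm (fun h => hadj h.symm)
            (lt_of_le_of_ne (not_lt.1 hlt) hne.symm)
        rw [hi.adj_iff hlt, not_not] at hadj
        obtain ⟨w, hw, h1, h2⟩ := hadj
        exact hsep hw h1 h2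
      · rw [SetLike.mem_coe]
        -- the outer two of three distinct vertices are separated by the middle one
        have key : ∀ {a w b : Fin (d + 1)}, w ∈ Set.range i → a < w → w < b →
            (X a * X w * X b : MvPolynomial (Fin (d + 1)) K) ∈ quadricIdeal K (Set.range i) := by
          intro a w b hw h1 h2
          rw [mul_right_comm]
          exact Ideal.mul_mem_right _ _ (hsep hw h1 h2)
        have hxy' : x ≠ y := fun h => hxy (Subtype.ext h)
        have hxz' : x ≠ z := fun h => hxz (Subtype.ext h)
        have hyz' : y ≠ z := fun h => hyz (Subtype.ext h)
        rcases lt_or_gt_of_ne hxy' with h1 | h1 <;> rcases lt_or_gt_of_ne hyz' with h2 | h2 <;>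
          rcases lt_or_gt_of_ne hxz' with h3 | h3
        · exact key hy h1 h2
        · exact key hy h1 h2
        · convert key hz h3 h2 using 1; ring
        · convert key hx h3 h1 using 1; ring
        · convert key hx h1 h3 using 1; ring
        · convert key hz h2 h3 using 1; ring
        · convert key hy h2 h1 using 1; ring
        · convert key hy h2 h1 using 1; ring
    · rw [sq, Ideal.span_mul_span', Ideal.span_le]
      rintro _ ⟨_, ⟨a, ha, rfl⟩, _, ⟨b, hb, rfl⟩, rfl⟩
      simp only [SetLike.mem_coe]
      wlog hab : a ≤ b generalizing a b
      · rw [mul_comm]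
        exact this b hb a ha (not_le.1 hab).le
      refine X_mul_X_mem_quadricIdeal K ⟨hab, ?_⟩
      by_contra! hc
      obtain ⟨hno, w, hw, h1, h2⟩ := hc
      refine absurd (hno w hw (lt_of_le_of_ne h1 ?_)) (not_le.2 (lt_of_le_of_ne h2 ?_))
      · rintro rfl; exact ha hw
      · rintro rfl; exact hb hw
    · refine Ideal.span_le.2 ?_
      rintro _ ⟨q, v, hv, rfl⟩
      rw [SetLike.mem_coe]
      obtain ⟨j, h1, h2⟩ := hi.exists_between q.2
      rw [hφ q j h1 h2, mem_lineEdge, not_or] at hv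
      obtain ⟨⟨_, l, rfl⟩, rfl⟩ : ∃ v', v' = v := ⟨v, rfl⟩
      rcases lt_or_gt_of_ne hv.1 with h | h
      · rw [mul_comm]
        exact hsep ⟨_, rfl⟩ h h1
      · refine hsep ⟨_, rfl⟩ h2 (lt_of_le_of_ne (not_lt.1 (hi.not_lt_of_lt h)) ?_)
        exact Ne.symm hv.2
  · refine Ideal.span_le.2 ?_
    rintro _ ⟨a, b, ⟨hab, hf⟩, rfl⟩
    rw [SetLike.mem_coe]
    by_cases ha : a ∈ Set.range i
    · obtain ⟨w, hw, h1, h2⟩ := hf.resolve_right fun h => h a ha ⟨le_rfl, hab⟩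
      by_cases hb : b ∈ Set.range i
      · refine Ideal.mem_sup_left (Ideal.subset_span (Or.inl ⟨⟨a, ha⟩, ⟨b, hb⟩, ?_, ?_, rfl⟩))
        · exact fun h => (h1.trans h2).ne (congrArg Subtype.val h)
        · rw [hi.adj_iff (h1.trans h2), not_not]
          exact ⟨w, hw, h1, h2⟩
      · refine Ideal.mem_sup_right (Ideal.mem_sup_right
          (Ideal.subset_span ⟨⟨b, hb⟩, ⟨a, ha⟩, ?_, mul_comm _ _⟩))
        obtain ⟨j, h3, h4⟩ := hi.exists_between hb
        rw [hφ ⟨b, hb⟩ j h3 h4, mem_lineEdge]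
        obtain ⟨l, rfl⟩ := hw
        rintro (h | h) <;> simp only at h
        · rw [h] at h1
          exact hi.not_lt_of_lt h1 (h2.trans h4)
        · rw [h] at h1
          exact lt_asymm (h1.trans h2) h4
    · by_cases hb : b ∈ Set.range i
      · obtain ⟨w, hw, h1, h2⟩ := hf.resolve_right fun h => h b hb ⟨hab, le_rfl⟩
        refine Ideal.mem_sup_right (Ideal.mem_sup_right
          (Ideal.subset_span ⟨⟨a, ha⟩, ⟨b, hb⟩, ?_, rfl⟩))
        obtain ⟨j, h3, h4⟩ := hi.exists_between ha
        rw [hφ ⟨a, ha⟩ j h3 h4, mem_lineEdge]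
        obtain ⟨l, rfl⟩ := hw
        rintro (h | h) <;> simp only at h
        · rw [h] at h2
          exact lt_asymm (h1.trans h2) h3
        · rw [h] at h2
          exact hi.not_lt_of_lt (h3.trans h1) h2
      · refine Ideal.mem_sup_right (Ideal.mem_sup_left ?_)
        rw [sq]
        exact Ideal.mul_mem_mul (Ideal.subset_span ⟨a, ha, rfl⟩) (Ideal.subset_span ⟨b, hb, rfl⟩)

lemma IsSubdivision.exists_isLineMap (hi : IsSubdivision d k i) :
    ∃ φ : ((Set.range i)ᶜ : Set (Fin (d + 1))) → (lineGraph i).edgeSet, IsLineMap i φ := by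
  choose j h1 h2 using fun s : ((Set.range i)ᶜ : Set (Fin (d + 1))) => hi.exists_between s.2
  refine ⟨fun s => ⟨lineEdge i (j s), ?_⟩, fun s j' h1' h2' => ?_⟩
  · rw [lineEdge, SimpleGraph.mem_edgeSet, lineGraph_adj_iff]
    exact ⟨⟨j s, rfl⟩, fun h => (hi.1 (Fin.castSucc_lt_succ (i := j s))).ne
      (congrArg Subtype.val h)⟩
  · simp only
    rw [hi.eq_of_between (h1 s) (h2 s) h1' h2']

end

end

end RNC

end

theorem mainTheorem4 {K : Type*} [Field K] (d : ℕ) (hd : 0 < d)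
    (I : Ideal (MvPolynomial (Fin (d + 1)) K)) (hI : RNC.IsMonomialIdeal I) :
    List.TFAE [
      ∃ (k : ℕ) (i : Fin (k + 1) → Fin (d + 1)), RNC.IsSubdivision d k i ∧
        ∃ φ : ((Set.range i)ᶜ : Set (Fin (d + 1))) → (RNC.lineGraph i).edgeSet,
          RNC.IsLineMap i φ ∧ RNC.treeIdeal K (RNC.lineGraph i) φ = I,
      ∃ (k : ℕ) (i : Fin (k + 1) → Fin (d + 1)), RNC.IsSubdivision d k i ∧
        I = RNC.diagonalIdeal K i,
      RNC.IsCohenMacaulay (MvPolynomial (Fin (d + 1)) K ⧸ I) ∧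
        ∃ τ : MonomialOrder.{0, 0} (Fin (d + 1)),
          I = RNC.termInitialIdeal τ (RNC.curveIdeal K d),
      RNC.IsCohenMacaulay (MvPolynomial (Fin (d + 1)) K ⧸ I) ∧
        ∃ a : Fin (d + 1) → ℚ, (∀ s, 0 ≤ a s) ∧
          I = RNC.weightInitialIdeal a (RNC.curveIdeal K d)] := by
  have hclass : RNC.IsCohenMacaulay (MvPolynomial (Fin (d + 1)) K ⧸ I) →
      RNC.IsSection (RNC.standard I) → ∃ (k : ℕ) (i : Fin (k + 1) → Fin (d + 1)),
        RNC.IsSubdivision d k i ∧ I = RNC.diagonalIdeal K i := by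
    intro hCM hsec
    obtain ⟨V, h0, hlast, hV⟩ := RNC.exists_eq_quadricIdeal hd hI hCM hsec
    obtain ⟨k, i, hi, rfl⟩ := RNC.exists_isSubdivision h0 hlast
    exact ⟨k, i, hi, by rw [RNC.diagonalIdeal_eq_quadricIdeal K hi, ← hV]⟩
  tfae_have 1 → 2 := by
    rintro ⟨k, i, hi, φ, hφ, rfl⟩
    exact ⟨k, i, hi, by
      rw [RNC.treeIdeal_eq_quadricIdeal K hi hφ, RNC.diagonalIdeal_eq_quadricIdeal K hi]⟩
  tfae_have 2 → 1 := by
    rintro ⟨k, i, hi, rfl⟩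
    obtain ⟨φ, hφ⟩ := hi.exists_isLineMap
    exact ⟨k, i, hi, φ, hφ, by
      rw [RNC.treeIdeal_eq_quadricIdeal K hi hφ, RNC.diagonalIdeal_eq_quadricIdeal K hi]⟩
  tfae_have 2 → 3 := by
    rintro ⟨k, i, hi, rfl⟩
    rw [RNC.diagonalIdeal_eq_quadricIdeal K hi]
    exact ⟨RNC.isCohenMacaulay_quadricIdeal K hd hi.zero_mem hi.last_mem, _,
      RNC.quadricIdeal_eq_termInitialIdeal K hd hi.zero_mem hi.last_mem⟩
  tfae_have 2 → 4 := by
    rintro ⟨k, i, hi, rfl⟩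
    rw [RNC.diagonalIdeal_eq_quadricIdeal K hi]
    exact ⟨RNC.isCohenMacaulay_quadricIdeal K hd hi.zero_mem hi.last_mem, _,
      fun _ => Nat.cast_nonneg _,
      RNC.quadricIdeal_eq_weightInitialIdeal K hd hi.zero_mem hi.last_mem⟩
  tfae_have 3 → 2 := by
    rintro ⟨hCM, τ, hτ⟩
    exact hclass hCM (hτ ▸ RNC.isSection_standard_termInitialIdeal hd τ)
  tfae_have 4 → 2 := by
    rintro ⟨hCM, a, -, ha⟩
    exact hclass hCM (ha ▸ RNC.isSection_standard_weightInitialIdeal hd a (ha ▸ hI))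
  tfae_finish
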